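/- Let $r,s\in\mathbb{C}^{*}$ be such that $r^{m}s^{n}=1$ with $m,n\in\mathbb{Z}$ implies $m=n=0$. Let $\check U=\check U^{\geq 0}_{r,s}(B_2)$ be the (underlying algebra of the) augmented Hopf algebra, that is, the associative unital $\mathbb{C}$-algebra generated by $e_1,e_2,k_1^{\pm1},k_2^{\pm1}$ subject to the relations $$k_1k_1^{-1}=k_1^{-1}k_1=1=k_2k_2^{-1}=k_2^{-1}k_2,\qquad k_1k_2=k_2k_1,$$ $$k_1e_1=s^{-2}e_1k_1,\qquad k_1e_2=rs\,e_2k_1,\qquad k_2e_1=r^{-1}s^{-1}e_1k_2,\qquad k_2e_2=r\,e_2k_2,$$ $$e_1^{2}e_2-(r^{2}+s^{2})e_1e_2e_1+r^{2}s^{2}e_2e_1^{2}=0,$$ $$e_1e_2^{3}-(r^{2}+rs+s^{2})e_2e_1e_2^{2}+rs(r^{2}+rs+s^{2})e_2^{2}e_1e_2-r^{3}s^{3}e_2^{3}e_1=0.$$ Let $\theta$ be a $\mathbb{C}$-algebra automorphism of $\check U$. Then there exist $\lambda_1,\lambda_2,\gamma_1,\gamma_2\in\mathbb{C}^{*}$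 and $a,b,c,d\in\mathbb{Z}$ with $b=2c$ and $a+2c+d=0$ such that $$\theta(k_1)=\lambda_1k_1,\qquad \theta(k_2)=\lambda_2k_2,\qquad \theta(e_1)=\gamma_1k_1^{a}k_2^{b}e_1,\qquad \theta(e_2)=\gamma_2k_1^{c}k_2^{d}e_2.$$ In particular, no automorphism exchanges the two generators $e_1,e_2$, even up to torus factors: there are no $\gamma\in\mathbb{C}$ and $m,n\in\mathbb{Z}$ with $\theta(e_1)=\gamma k_1^{m}k_2^{n}e_2$, and none with $\theta(e_2)=\gamma k_1^{m}k_2^{n}e_1$. -/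

import Mathlib

namespace AugB2

/-- Names of the generators: `e₁, e₂, k₁, k₁⁻¹, k₂, k₂⁻¹`. -/
inductive Gen : Type
  | e₁ | e₂ | k₁ | k₁inv | k₂ | k₂inv

open Gen in
/-- The defining relations of the augmented algebra `Ǔ^{≥0}_{r,s}(B₂)`, as a relation on the free
associative algebra on the generators. -/
inductive Rel (r s : ℂ) : FreeAlgebra ℂ Gen → FreeAlgebra ℂ Gen → Prop
  | k₁_mul_inv : Rel r s (.ι ℂ k₁ * .ι ℂ k₁inv) 1
  | k₁_inv_mul : Rel r s (.ι ℂ k₁inv * .ι ℂ k₁) 1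
  | k₂_mul_inv : Rel r s (.ι ℂ k₂ * .ι ℂ k₂inv) 1
  | k₂_inv_mul : Rel r s (.ι ℂ k₂inv * .ι ℂ k₂) 1
  | k₁_k₂ : Rel r s (.ι ℂ k₁ * .ι ℂ k₂) (.ι ℂ k₂ * .ι ℂ k₁)
  | k₁_e₁ : Rel r s (.ι ℂ k₁ * .ι ℂ e₁) ((s ^ 2)⁻¹ • (.ι ℂ e₁ * .ι ℂ k₁))
  | k₁_e₂ : Rel r s (.ι ℂ k₁ * .ι ℂ e₂) ((r * s) • (.ι ℂ e₂ * .ι ℂ k₁))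
  | k₂_e₁ : Rel r s (.ι ℂ k₂ * .ι ℂ e₁) ((r⁻¹ * s⁻¹) • (.ι ℂ e₁ * .ι ℂ k₂))
  | k₂_e₂ : Rel r s (.ι ℂ k₂ * .ι ℂ e₂) (r • (.ι ℂ e₂ * .ι ℂ k₂))
  | serre₁ : Rel r s
      (.ι ℂ e₁ ^ 2 * .ι ℂ e₂ - (r ^ 2 + s ^ 2) • (.ι ℂ e₁ * .ι ℂ e₂ * .ι ℂ e₁)
        + (r ^ 2 * s ^ 2) • (.ι ℂ e₂ * .ι ℂ e₁ ^ 2)) 0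
  | serre₂ : Rel r s
      (.ι ℂ e₁ * .ι ℂ e₂ ^ 3 - (r ^ 2 + r * s + s ^ 2) • (.ι ℂ e₂ * .ι ℂ e₁ * .ι ℂ e₂ ^ 2)
        + (r * s * (r ^ 2 + r * s + s ^ 2)) • (.ι ℂ e₂ ^ 2 * .ι ℂ e₁ * .ι ℂ e₂)
        - (r ^ 3 * s ^ 3) • (.ι ℂ e₂ ^ 3 * .ι ℂ e₁)) 0

/-- The (underlying `ℂ`-algebra of the) augmented Hopf algebra `Ǔ^{≥0}_{r,s}(B₂)`. -/
def UCheck (r s : ℂ) : Type := RingQuot (Rel r s)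

noncomputable section

instance (r s : ℂ) : Ring (UCheck r s) := inferInstanceAs (Ring (RingQuot (Rel r s)))

instance (r s : ℂ) : Algebra ℂ (UCheck r s) := inferInstanceAs (Algebra ℂ (RingQuot (Rel r s)))

/-- The quotient map from the free algebra. -/
def mk (r s : ℂ) : FreeAlgebra ℂ Gen →ₐ[ℂ] UCheck r s := RingQuot.mkAlgHom ℂ (Rel r s)

theorem mk_eq_of_rel {r s : ℂ} {x y : FreeAlgebra ℂ Gen} (h : Rel r s x y) :
    mk r s x = mk r s y := RingQuot.mkAlgHom_rel ℂ h

/-- The generator `e₁`. -/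
def e₁ (r s : ℂ) : UCheck r s := mk r s (.ι ℂ Gen.e₁)

/-- The generator `e₂`. -/
def e₂ (r s : ℂ) : UCheck r s := mk r s (.ι ℂ Gen.e₂)

/-- The invertible generator `k₁`, as a unit (so that `k₁ ^ m` makes sense for `m : ℤ`). -/
def k₁ (r s : ℂ) : (UCheck r s)ˣ where
  val := mk r s (.ι ℂ Gen.k₁)
  inv := mk r s (.ι ℂ Gen.k₁inv)
  val_inv := by simpa using mk_eq_of_rel (Rel.k₁_mul_inv (r := r) (s := s))
  inv_val := by simpa using mk_eq_of_rel (Rel.k₁_inv_mul (r := r) (s := s))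

/-- The invertible generator `k₂`, as a unit. -/
def k₂ (r s : ℂ) : (UCheck r s)ˣ where
  val := mk r s (.ι ℂ Gen.k₂)
  inv := mk r s (.ι ℂ Gen.k₂inv)
  val_inv := by simpa using mk_eq_of_rel (Rel.k₂_mul_inv (r := r) (s := s))
  inv_val := by simpa using mk_eq_of_rel (Rel.k₂_inv_mul (r := r) (s := s))

/-- The element `k₁ᵐ k₂ⁿ`. -/
def kpow (r s : ℂ) (m n : ℤ) : UCheck r s := ((k₁ r s ^ m * k₂ r s ^ n : (UCheck r s)ˣ) : UCheck r s)

end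

end AugB2

/-! The algebra is embedded in a quantum torus, where zero divisors, units and gradings can be read
off from exponents. `torusHom` sends `e₂`, `k₁`, `k₂` to monomials and `e₁` to a sum of four
monomials, in the style of a Feigin homomorphism. Ordered monomials in the root vectors `e₂`, `e₄`,
`e₃`, `e₁` span (`mem_span_pbw`), and their images have distinct leading exponents for the
lexicographic order. So they form a basis and the map is injective (`torusHom_injective`).

A unit of the torus is a monomial. Weights in the algebra are nonnegative, so a unit and its inverse
have weight zero, and units are scalar multiples of `kpow` (`eq_smul_kpow_of_mul_eq_one`). An
automorphism therefore sends `k₁`, `k₂` to such elements. Since `r`, `s` are multiplicatively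
independent, the commutation relations become integer equations for the new torus exponents and the
weights of the images of `e₁`, `e₂`. Nonnegativity forces the original values (`weight_equations`).

Thus each `e₁`, `e₂` goes to a left multiple of itself. The same holds for the inverse automorphism,
so the multiplier is a unit. The first Serre relation then yields both linear constraints on the
exponents (`twist_eq`), and comparing weights excludes an exchange. -/

/-- A nowhere vanishing bicharacter `G × G → F`. -/
structure Bichar (F G : Type*) [Field F] [AddCommGroup G] where
  toFun : G → G → F
  ne_zero : ∀ a b, toFun a b ≠ 0
  add_left : ∀ a b c, toFun (a + b) c = toFun a c * toFun b c
  add_right : ∀ a b c, toFun a (b + c) = toFun a b * toFun a c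

/-- The twisted group algebra: basis `x^a`, `a : G`, and product `x^a x^b = q(a,b) x^(a+b)`. -/
def TwistedAlgebra {F G : Type*} [Field F] [AddCommGroup G] (_q : Bichar F G) : Type _ := G →₀ F

/-! ### Twisted group algebras: product, coefficients, gradings. -/

noncomputable section TwistedAlgebraSection

namespace Bichar

variable {F G : Type*} [Field F] [AddCommGroup G] (q : Bichar F G)

theorem zero_left (a : G) : q.toFun 0 a = 1 := by
  have h := q.add_left 0 0 a
  rw [add_zero] at h
  exact (mul_eq_left₀ (q.ne_zero 0 a)).1 h.symm

theorem zero_right (a : G) : q.toFun a 0 = 1 := by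
  have h := q.add_right a 0 0
  rw [add_zero] at h
  exact (mul_eq_left₀ (q.ne_zero a 0)).1 h.symm

end Bichar

namespace TwistedAlgebra

variable {F G : Type*} [Field F] [AddCommGroup G] {q : Bichar F G}

instance : AddCommGroup (TwistedAlgebra q) := inferInstanceAs (AddCommGroup (G →₀ F))

instance : Module F (TwistedAlgebra q) := inferInstanceAs (Module F (G →₀ F))

/-- The coefficient of `x^a`. -/
def coeff (t : TwistedAlgebra q) (a : G) : F := (show G →₀ F from t) a

/-- The set of exponents with a nonzero coefficient. -/
def support (t : TwistedAlgebra q) : Finset G := Finsupp.support (show G →₀ F from t)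

/-- The monomial `c x^a`. -/
def mono (q : Bichar F G) (a : G) (c : F) : TwistedAlgebra q := Finsupp.single a c

theorem mem_support {t : TwistedAlgebra q} {a : G} : a ∈ t.support ↔ t.coeff a ≠ 0 :=
  Finsupp.mem_support_iff

theorem ext_coeff {t u : TwistedAlgebra q} (h : ∀ a, t.coeff a = u.coeff a) : t = u :=
  Finsupp.ext h

@[simp] theorem coeff_zero (a : G) : (0 : TwistedAlgebra q).coeff a = 0 := rfl

@[simp] theorem coeff_add (t u : TwistedAlgebra q) (a : G) :
    (t + u).coeff a = t.coeff a + u.coeff a := rfl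

@[simp] theorem coeff_smul (c : F) (t : TwistedAlgebra q) (a : G) :
    (c • t).coeff a = c * t.coeff a := rfl

open Classical in
theorem coeff_mono (a b : G) (c : F) : (mono q a c).coeff b = if a = b then c else 0 :=
  Finsupp.single_apply

@[simp] theorem coeff_mono_self (a : G) (c : F) : (mono q a c).coeff a = c :=
  Finsupp.single_eq_same

theorem smul_mono (a : G) (c d : F) : c • mono q a d = mono q a (c * d) :=
  Finsupp.smul_single _ _ _

theorem induction_mono {p : TwistedAlgebra q → Prop} (t : TwistedAlgebra q) (h0 : p 0)
    (hadd : ∀ u v, p u → p v → p (u + v)) (hm : ∀ a c, p (mono q a c)) : p t :=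
  Finsupp.induction_linear t h0 hadd hm

/-- The product, as a bilinear map. -/
def mulBilin (q : Bichar F G) : (G →₀ F) →ₗ[F] (G →₀ F) →ₗ[F] (G →₀ F) :=
  Finsupp.lsum F fun a => LinearMap.toSpanSingleton F _
    (Finsupp.lsum F fun b => LinearMap.toSpanSingleton F _ (Finsupp.single (a + b) (q.toFun a b)))

instance : Mul (TwistedAlgebra q) := ⟨fun t u => mulBilin q t u⟩

instance : One (TwistedAlgebra q) := ⟨mono q 0 1⟩

theorem one_def : (1 : TwistedAlgebra q) = mono q 0 1 := rfl

theorem mono_mul_mono (a b : G) (c d : F) :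
    mono q a c * mono q b d = mono q (a + b) (c * d * q.toFun a b) := by
  change mulBilin q (Finsupp.single a c) (Finsupp.single b d) = Finsupp.single _ _
  simp only [mulBilin, Finsupp.lsum_single, LinearMap.toSpanSingleton_apply, LinearMap.smul_apply,
    Finsupp.smul_single, smul_eq_mul, mul_assoc]

protected theorem mul_add' (t u v : TwistedAlgebra q) : t * (u + v) = t * u + t * v :=
  map_add (mulBilin q t) u v

protected theorem add_mul' (t u v : TwistedAlgebra q) : (t + u) * v = t * v + u * v :=
  LinearMap.map_add₂ (mulBilin q) t u v

protected theorem zero_mul' (t : TwistedAlgebra q) : 0 * t = 0 :=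
  LinearMap.map_zero₂ (mulBilin q) t

protected theorem mul_zero' (t : TwistedAlgebra q) : t * 0 = 0 :=
  map_zero (mulBilin q t)

instance : Ring (TwistedAlgebra q) :=
  { (inferInstance : AddCommGroup (TwistedAlgebra q)) with
    mul := (· * ·)
    one := 1
    left_distrib := TwistedAlgebra.mul_add'
    right_distrib := TwistedAlgebra.add_mul'
    zero_mul := TwistedAlgebra.zero_mul'
    mul_zero := TwistedAlgebra.mul_zero'
    one_mul := fun t => by
      induction t using induction_mono with
      | h0 => exact TwistedAlgebra.mul_zero' 1
      | hadd u v hu hv => rw [TwistedAlgebra.mul_add', hu, hv]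
      | hm a c => rw [one_def, mono_mul_mono, zero_add, one_mul, q.zero_left, mul_one]
    mul_one := fun t => by
      induction t using induction_mono with
      | h0 => exact TwistedAlgebra.zero_mul' 1
      | hadd u v hu hv => rw [TwistedAlgebra.add_mul', hu, hv]
      | hm a c => rw [one_def, mono_mul_mono, add_zero, mul_one, q.zero_right, mul_one]
    mul_assoc := fun t u v => by
      induction t using induction_mono with
      | h0 => simp only [TwistedAlgebra.zero_mul']
      | hadd t₁ t₂ h₁ h₂ => simp only [TwistedAlgebra.add_mul', h₁, h₂]
      | hm a c =>
        induction u using induction_mono with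
        | h0 => simp only [TwistedAlgebra.zero_mul', TwistedAlgebra.mul_zero']
        | hadd t₁ t₂ h₁ h₂ =>
          simp only [TwistedAlgebra.add_mul', TwistedAlgebra.mul_add', h₁, h₂]
        | hm b d =>
          induction v using induction_mono with
          | h0 => simp only [TwistedAlgebra.mul_zero']
          | hadd t₁ t₂ h₁ h₂ => simp only [TwistedAlgebra.mul_add', h₁, h₂]
          | hm b d =>
            simp only [mono_mul_mono, q.add_left, q.add_right, add_assoc]
            congr 1
            ring }

instance : Algebra F (TwistedAlgebra q) :=
  Algebra.ofModule (fun c t u => LinearMap.map_smul₂ (mulBilin q) c t u)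
    (fun c t u => map_smul (mulBilin q t) c u)

theorem coeff_mono_mul (a b : G) (c : F) (t : TwistedAlgebra q) :
    (mono q a c * t).coeff (a + b) = c * t.coeff b * q.toFun a b := by
  induction t using induction_mono with
  | h0 => simp
  | hadd u v hu hv => rw [mul_add, coeff_add, hu, hv, coeff_add]; ring
  | hm d e =>
    rw [mono_mul_mono, coeff_mono, coeff_mono]
    by_cases h : d = b
    · subst h; simp
    · simp [h]

theorem coeff_mul_mono (a b : G) (c : F) (t : TwistedAlgebra q) :
    (t * mono q a c).coeff (b + a) = t.coeff b * c * q.toFun b a := by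
  induction t using induction_mono with
  | h0 => simp
  | hadd u v hu hv => rw [add_mul, coeff_add, hu, hv, coeff_add]; ring
  | hm d e =>
    rw [mono_mul_mono, coeff_mono, coeff_mono]
    by_cases h : d = b
    · subst h; simp
    · simp [h]

theorem coeff_sum {ι : Type*} (S : Finset ι) (f : ι → TwistedAlgebra q) (a : G) :
    (∑ i ∈ S, f i).coeff a = ∑ i ∈ S, (f i).coeff a :=
  Finsupp.finsetSum_apply S f a

theorem sum_mono (t : TwistedAlgebra q) : ∑ a ∈ t.support, mono q a (t.coeff a) = t :=
  Finsupp.sum_single (show G →₀ F from t)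

theorem coeff_mul (t u : TwistedAlgebra q) (a : G) :
    (t * u).coeff a = ∑ b ∈ t.support, t.coeff b * u.coeff (-b + a) * q.toFun b (-b + a) := by
  conv_lhs => rw [← sum_mono t, Finset.sum_mul, coeff_sum]
  refine Finset.sum_congr rfl fun b _ => ?_
  conv_lhs => rw [← add_neg_cancel_left b a]
  exact coeff_mono_mul _ _ _ _

theorem exists_of_coeff_mul_ne_zero {t u : TwistedAlgebra q} {a : G} (h : (t * u).coeff a ≠ 0) :
    ∃ b c, t.coeff b ≠ 0 ∧ u.coeff c ≠ 0 ∧ b + c = a := by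
  rw [coeff_mul] at h
  obtain ⟨b, -, hb⟩ := Finset.exists_ne_zero_of_sum_ne_zero h
  exact ⟨b, -b + a, fun h0 => hb (by simp [h0]), fun h0 => hb (by simp [h0]), by abel⟩

/-- No cancellation is possible at an exponent that is a sum in only one way; this is applied to
extremal exponents. -/
theorem coeff_mul_of_unique {t u : TwistedAlgebra q} {a b : G}
    (h : ∀ c d, t.coeff c ≠ 0 → u.coeff d ≠ 0 → c + d = a + b → c = a) :
    (t * u).coeff (a + b) = t.coeff a * u.coeff b * q.toFun a b := by
  rw [coeff_mul, Finset.sum_eq_single a]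
  · rw [neg_add_cancel_left]
  · intro c hc hca
    by_cases hu : u.coeff (-c + (a + b)) = 0
    · rw [hu]; ring
    · exact absurd (h c _ (mem_support.1 hc) hu (by abel)) hca
  · intro ha
    rw [mem_support, not_not] at ha
    rw [ha]; ring

theorem exists_coeff_ne_zero {t : TwistedAlgebra q} (h : t ≠ 0) : ∃ a, t.coeff a ≠ 0 := by
  by_contra! h0
  exact h (ext_coeff h0)

/-- All exponents occurring in `t` have weight `w` under `f`. -/
def Homog {W : Type*} [AddCommGroup W] (f : G →+ W) (w : W) (t : TwistedAlgebra q) : Prop :=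
  ∀ a, t.coeff a ≠ 0 → f a = w

section Homog

variable {W : Type*} [AddCommGroup W] {f : G →+ W}

theorem Homog.mul {w w' : W} {t u : TwistedAlgebra q} (ht : Homog f w t) (hu : Homog f w' u) :
    Homog f (w + w') (t * u) := by
  intro a ha
  obtain ⟨b, c, hb, hc, rfl⟩ := exists_of_coeff_mul_ne_zero ha
  rw [map_add, ht b hb, hu c hc]

theorem Homog.add {w : W} {t u : TwistedAlgebra q} (ht : Homog f w t) (hu : Homog f w u) :
    Homog f w (t + u) := by
  intro a ha
  by_cases h : t.coeff a = 0
  · exact hu a fun h' => ha (by rw [coeff_add, h, h', add_zero])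
  · exact ht a h

theorem Homog.smul {w : W} {t : TwistedAlgebra q} (c : F) (ht : Homog f w t) :
    Homog f w (c • t) :=
  fun a ha => ht a fun h => ha (by rw [coeff_smul, h, mul_zero])

theorem homog_mono (a : G) (c : F) : Homog f (f a) (mono q a c) := by
  intro b hb
  rw [coeff_mono] at hb
  split_ifs at hb with h
  · rw [h]
  · exact absurd rfl hb

theorem Homog.pow {w : W} {t : TwistedAlgebra q} (ht : Homog f w t) (n : ℕ) :
    Homog f (n • w) (t ^ n) := by
  induction n with
  | zero => rw [pow_zero, zero_smul, ← map_zero f]; exact homog_mono 0 1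
  | succ n ih => rw [pow_succ, succ_nsmul]; exact ih.mul ht

end Homog

/-! ### Leading and trailing exponents over an ordered group. -/

section Order

variable [LinearOrder G]

/-- `a` is the largest exponent occurring in `t`. -/
def IsLead (t : TwistedAlgebra q) (a : G) : Prop :=
  t.coeff a ≠ 0 ∧ ∀ b, t.coeff b ≠ 0 → b ≤ a

/-- `a` is the smallest exponent occurring in `t`. -/
def IsTrail (t : TwistedAlgebra q) (a : G) : Prop :=
  t.coeff a ≠ 0 ∧ ∀ b, t.coeff b ≠ 0 → a ≤ b

theorem exists_isLead {t : TwistedAlgebra q} (h : t ≠ 0) : ∃ a, IsLead t a := by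
  obtain ⟨a, ha⟩ := exists_coeff_ne_zero h
  obtain ⟨b, hb, hmax⟩ := t.support.exists_max_image id ⟨a, mem_support.2 ha⟩
  exact ⟨b, mem_support.1 hb, fun c hc => hmax c (mem_support.2 hc)⟩

theorem exists_isTrail {t : TwistedAlgebra q} (h : t ≠ 0) : ∃ a, IsTrail t a := by
  obtain ⟨a, ha⟩ := exists_coeff_ne_zero h
  obtain ⟨b, hb, hmin⟩ := t.support.exists_min_image id ⟨a, mem_support.2 ha⟩
  exact ⟨b, mem_support.1 hb, fun c hc => hmin c (mem_support.2 hc)⟩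

theorem IsLead.ne_zero {t : TwistedAlgebra q} {a : G} (h : IsLead t a) : t ≠ 0 := by
  rintro rfl
  exact h.1 rfl

theorem isLead_mono (a : G) {c : F} (hc : c ≠ 0) : IsLead (mono q a c) a := by
  refine ⟨by simpa using hc, fun b hb => ?_⟩
  rw [coeff_mono] at hb
  split_ifs at hb with h
  · exact h.ge
  · exact absurd rfl hb

theorem IsLead.add_mono {t : TwistedAlgebra q} {a b : G} (ht : IsLead t a) (hb : b < a) (c : F) :
    IsLead (t + mono q b c) a := by
  constructor
  · rw [coeff_add, coeff_mono, if_neg hb.ne, add_zero]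
    exact ht.1
  · intro d hd
    rw [coeff_add, coeff_mono] at hd
    split_ifs at hd with h
    · exact h ▸ hb.le
    · exact ht.2 d (by simpa using hd)

theorem eq_mono_of_isLead_of_isTrail {t : TwistedAlgebra q} {a : G} (h : IsLead t a)
    (h' : IsTrail t a) : t = mono q a (t.coeff a) := by
  refine ext_coeff fun b => ?_
  rw [coeff_mono]
  split_ifs with hab
  · rw [hab]
  · by_contra hb
    exact hab (le_antisymm (h'.2 b hb) (h.2 b hb))

/-- Elements with pairwise distinct leading exponents are linearly independent. -/
theorem eq_zero_of_sum_eq_zero_of_isLead {ι : Type*} (f : ι → TwistedAlgebra q) (l : ι → G)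
    (hl : Function.Injective l) (hf : ∀ i, IsLead (f i) (l i)) (c : ι →₀ F)
    (h : (c.sum fun i x => x • f i) = 0) : c = 0 := by
  by_contra hc
  obtain ⟨i, hi, hmax⟩ := c.support.exists_max_image l (Finsupp.support_nonempty_iff.2 hc)
  have h1 : (∑ j ∈ c.support, c j • f j).coeff (l i) = 0 := by
    change (c.sum fun i x => x • f i).coeff (l i) = 0
    rw [h]; rfl
  rw [coeff_sum, Finset.sum_eq_single_of_mem i hi, coeff_smul] at h1
  · exact mul_ne_zero (Finsupp.mem_support_iff.1 hi) (hf i).1 h1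
  · intro j hj hji
    rw [coeff_smul]
    by_contra hne
    exact hji (hl (le_antisymm (hmax j hj) ((hf j).2 _ (right_ne_zero_of_mul hne))))

theorem one_ne_zero' : (1 : TwistedAlgebra q) ≠ 0 := (isLead_mono (q := q) 0 one_ne_zero).ne_zero

variable [IsOrderedCancelAddMonoid G]

theorem IsLead.mul {t u : TwistedAlgebra q} {a b : G} (ht : IsLead t a) (hu : IsLead u b) :
    IsLead (t * u) (a + b) := by
  constructor
  · rw [coeff_mul_of_unique]
    · exact mul_ne_zero (mul_ne_zero ht.1 hu.1) (q.ne_zero a b)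
    · intro c d hc hd h
      refine le_antisymm (ht.2 c hc) (le_of_not_gt fun hlt => ?_)
      exact absurd h (add_lt_add_of_lt_of_le hlt (hu.2 d hd)).ne
  · intro c hc
    obtain ⟨d, e, hd, he, rfl⟩ := exists_of_coeff_mul_ne_zero hc
    exact add_le_add (ht.2 d hd) (hu.2 e he)

theorem IsTrail.mul {t u : TwistedAlgebra q} {a b : G} (ht : IsTrail t a) (hu : IsTrail u b) :
    IsTrail (t * u) (a + b) := by
  constructor
  · rw [coeff_mul_of_unique]
    · exact mul_ne_zero (mul_ne_zero ht.1 hu.1) (q.ne_zero a b)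
    · intro c d hc hd h
      refine le_antisymm (le_of_not_gt fun hlt => ?_) (ht.2 c hc)
      exact absurd h (add_lt_add_of_lt_of_le hlt (hu.2 d hd)).ne'
  · intro c hc
    obtain ⟨d, e, hd, he, rfl⟩ := exists_of_coeff_mul_ne_zero hc
    exact add_le_add (ht.2 d hd) (hu.2 e he)

theorem IsLead.pow {t : TwistedAlgebra q} {a : G} (ht : IsLead t a) (n : ℕ) :
    IsLead (t ^ n) (n • a) := by
  induction n with
  | zero => rw [pow_zero, zero_smul]; exact isLead_mono 0 one_ne_zero
  | succ n ih => rw [pow_succ, succ_nsmul]; exact ih.mul ht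

theorem mul_ne_zero_of_ne_zero {t u : TwistedAlgebra q} (ht : t ≠ 0) (hu : u ≠ 0) : t * u ≠ 0 := by
  obtain ⟨a, ha⟩ := exists_isLead ht
  obtain ⟨b, hb⟩ := exists_isLead hu
  exact (ha.mul hb).ne_zero

/-- The leading exponents of the factors sum to zero, and so do the trailing ones. Hence in each
factor the two coincide. -/
theorem eq_mono_of_mul_eq_one {t u : TwistedAlgebra q} (h : t * u = 1) :
    ∃ a, t.coeff a ≠ 0 ∧ u.coeff (-a) ≠ 0 ∧ t = mono q a (t.coeff a) := by
  have ht : t ≠ 0 := by rintro rfl; exact one_ne_zero' (q := q) (by rw [← h, zero_mul])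
  have hu : u ≠ 0 := by rintro rfl; exact one_ne_zero' (q := q) (by rw [← h, mul_zero])
  obtain ⟨a, ha⟩ := exists_isLead ht
  obtain ⟨b, hb⟩ := exists_isLead hu
  obtain ⟨a', ha'⟩ := exists_isTrail ht
  obtain ⟨b', hb'⟩ := exists_isTrail hu
  have key : ∀ c, (t * u).coeff c ≠ 0 → c = 0 := by
    intro c hc
    rw [h, one_def, coeff_mono] at hc
    by_contra hne
    exact hc (if_neg (Ne.symm hne))
  have h1 := key _ (ha.mul hb).1
  have h2 := key _ (ha'.mul hb').1
  have h3 : a' ≤ a := ha.2 a' ha'.1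
  have h4 : b' ≤ b := hb.2 b' hb'.1
  have h5 : a' = a := by
    refine le_antisymm h3 (le_of_not_gt fun hlt => ?_)
    exact absurd (h2.trans h1.symm) (add_lt_add_of_lt_of_le hlt h4).ne
  rw [h5] at ha'
  refine ⟨a, ha.1, ?_, eq_mono_of_isLead_of_isTrail ha ha'⟩
  rw [neg_eq_of_add_eq_zero_right h1]
  exact hb.1

end Order

end TwistedAlgebra

end TwistedAlgebraSection

/-! ### Spanning sets for iterated skew extensions. -/

section Spanning

variable {F A : Type*} [Field F] [Ring A] [Algebra F A]

/-- A left ideal-like criterion: a subspace containing `1` and stable under left multiplication by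
`g` contains the subalgebra generated by `g`. -/
theorem mem_of_mem_adjoin {g : Set A} (N : Submodule F A) (h1 : (1 : A) ∈ N)
    (hg : ∀ y ∈ g, ∀ z ∈ N, y * z ∈ N) {b : A} (hb : b ∈ Algebra.adjoin F g) : b ∈ N := by
  suffices h : ∀ z ∈ N, b * z ∈ N by simpa using h 1 h1
  induction hb using Algebra.adjoin_induction with
  | mem x hx => exact hg x hx
  | algebraMap c => exact fun z hz => by rw [← Algebra.smul_def]; exact N.smul_mem c hz
  | add x y _ _ hx hy => exact fun z hz => by rw [add_mul]; exact N.add_mem (hx z hz) (hy z hz)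
  | mul x y _ _ hx hy => exact fun z hz => by rw [mul_assoc]; exact hx _ (hy z hz)

/-- The inclusion `x B ⊆ B x + B` need only be tested on generators of `B`, since `x` moves past a
product one factor at a time. -/
theorem exists_mul_eq_of_mem_adjoin {g : Set A} {x : A}
    (hx : ∀ y ∈ g, ∃ b ∈ Algebra.adjoin F g, ∃ c ∈ Algebra.adjoin F g, x * y = b * x + c)
    {y : A} (hy : y ∈ Algebra.adjoin F g) :
    ∃ b ∈ Algebra.adjoin F g, ∃ c ∈ Algebra.adjoin F g, x * y = b * x + c := by
  induction hy using Algebra.adjoin_induction with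
  | mem y hy => exact hx y hy
  | algebraMap c =>
    exact ⟨_, Subalgebra.algebraMap_mem _ c, 0, zero_mem _,
      by rw [add_zero, Algebra.commutes]⟩
  | add y z _ _ hy hz =>
    obtain ⟨b, hb, c, hc, h⟩ := hy
    obtain ⟨b', hb', c', hc', h'⟩ := hz
    exact ⟨b + b', add_mem hb hb', c + c', add_mem hc hc', by rw [mul_add, h, h']; noncomm_ring⟩
  | mul y z hym hzm hy hz =>
    obtain ⟨b, hb, c, hc, h⟩ := hy
    obtain ⟨b', hb', c', hc', h'⟩ := hz
    refine ⟨b * b', mul_mem hb hb', b * c' + c * z, add_mem (mul_mem hb hc') (mul_mem hc hzm), ?_⟩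
    rw [← mul_assoc, h, add_mul, mul_assoc, h']
    noncomm_ring

/-- Adjoining to a subalgebra spanned by `f i` an element `x` with `x B ⊆ B x + B` gives an algebra
spanned by the `f i * x ^ n`. -/
theorem mem_span_of_mem_adjoin_insert {ι : Type*} {f : ι → A} {g : Set A} {x : A}
    (hB : ∀ b ∈ Algebra.adjoin F g, b ∈ Submodule.span F (Set.range f))
    (hx : ∀ y ∈ g, ∃ b ∈ Algebra.adjoin F g, ∃ c ∈ Algebra.adjoin F g, x * y = b * x + c)
    {b : A} (hb : b ∈ Algebra.adjoin F (insert x g)) :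
    b ∈ Submodule.span F (Set.range fun p : ι × ℕ => f p.1 * x ^ p.2) := by
  set N : Submodule F A :=
    Submodule.span F {a | ∃ b ∈ Algebra.adjoin F g, ∃ n : ℕ, a = b * x ^ n} with hN
  have hmem : ∀ b ∈ Algebra.adjoin F g, ∀ n : ℕ, b * x ^ n ∈ N := fun b hb n =>
    Submodule.subset_span ⟨b, hb, n, rfl⟩
  have hbN : b ∈ N := by
    refine mem_of_mem_adjoin N (by simpa using hmem 1 (one_mem _) 0) ?_ hb
    intro y hy z hz
    induction hz using Submodule.span_induction with
    | mem z hz =>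
      obtain ⟨b, hb, n, rfl⟩ := hz
      rcases Set.mem_insert_iff.1 hy with hyx | hy
      · obtain ⟨b', hb', c', hc', h⟩ := exists_mul_eq_of_mem_adjoin hx hb
        rw [hyx, ← mul_assoc, h, add_mul, mul_assoc, ← pow_succ']
        exact add_mem (hmem _ hb' _) (hmem _ hc' _)
      · rw [← mul_assoc]
        exact hmem _ (mul_mem (Algebra.subset_adjoin hy) hb) n
    | zero => rw [mul_zero]; exact zero_mem _
    | add z w _ _ hz hw => rw [mul_add]; exact add_mem hz hw
    | smul c z _ hz => rw [mul_smul_comm]; exact N.smul_mem c hz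
  refine Submodule.span_le.2 ?_ hbN
  rintro _ ⟨b, hb, n, rfl⟩
  have hb' := hB b hb
  clear hb
  change b * x ^ n ∈ Submodule.span F (Set.range fun p : ι × ℕ => f p.1 * x ^ p.2)
  induction hb' using Submodule.span_induction with
  | mem z hz =>
    obtain ⟨i, rfl⟩ := hz
    exact Submodule.subset_span ⟨(i, n), rfl⟩
  | zero => rw [zero_mul]; exact zero_mem _
  | add z w _ _ hz hw => rw [add_mul]; exact add_mem hz hw
  | smul c z _ hz => rw [smul_mul_assoc]; exact Submodule.smul_mem _ c hz

end Spanning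

namespace AugB2

/-! ### Root vectors and their straightening relations. -/

section RootVectors

variable {F A : Type*} [Field F] [Ring A] [Algebra F A] {r s : F} {x₁ x₂ x₃ x₄ : A}

/-- Expand `x₄` as a twisted commutator and move `x₁` to the right; the `x₃` released on passing
`x₂` produces the square. -/
theorem root_mul_left (h₁₂ : x₁ * x₂ = r ^ 2 • (x₂ * x₁) + x₃) (h₁₃ : x₁ * x₃ = s ^ 2 • (x₃ * x₁))
    (h₃₂ : x₃ * x₂ = (r * s) • (x₂ * x₃) + x₄) :
    x₁ * x₄ = (r ^ 2 * s ^ 2) • (x₄ * x₁) + (s ^ 2 - r * s) • (x₃ * x₃) := by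
  have h₄ : x₄ = x₃ * x₂ - (r * s) • (x₂ * x₃) := by rw [h₃₂]; abel
  have h₁₂' (z : A) : x₁ * (x₂ * z) = r ^ 2 • (x₂ * (x₁ * z)) + x₃ * z := by
    rw [← mul_assoc, h₁₂, add_mul, smul_mul_assoc, mul_assoc]
  have h₁₃' (z : A) : x₁ * (x₃ * z) = s ^ 2 • (x₃ * (x₁ * z)) := by
    rw [← mul_assoc, h₁₃, smul_mul_assoc, mul_assoc]
  rw [h₄]
  simp only [mul_sub, sub_mul, mul_assoc, mul_smul_comm, smul_mul_assoc, h₁₂', h₁₃', h₁₂, h₁₃,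
    smul_add, smul_sub, smul_smul, mul_add]
  module

/-- The overlap `x₁ x₄ x₂` is straightened in two ways; the difference is `r s` times the desired
relation. -/
theorem root_mul_root (hr : r ≠ 0) (hs : s ≠ 0)
    (h₁₂ : x₁ * x₂ = r ^ 2 • (x₂ * x₁) + x₃) (h₁₃ : x₁ * x₃ = s ^ 2 • (x₃ * x₁))
    (h₃₂ : x₃ * x₂ = (r * s) • (x₂ * x₃) + x₄) (h₄₂ : x₄ * x₂ = s ^ 2 • (x₂ * x₄)) :
    x₃ * x₄ = s ^ 2 • (x₄ * x₃) := by
  have h₁₄ := root_mul_left h₁₂ h₁₃ h₃₂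
  have h : x₁ * (x₄ * x₂) = (x₁ * x₄) * x₂ := (mul_assoc _ _ _).symm
  have h₁₂' (z : A) : x₁ * (x₂ * z) = r ^ 2 • (x₂ * (x₁ * z)) + x₃ * z := by
    rw [← mul_assoc, h₁₂, add_mul, smul_mul_assoc, mul_assoc]
  have h₃₂' (z : A) : x₃ * (x₂ * z) = (r * s) • (x₂ * (x₃ * z)) + x₄ * z := by
    rw [← mul_assoc, h₃₂, add_mul, smul_mul_assoc, mul_assoc]
  have h₄₂' (z : A) : x₄ * (x₂ * z) = s ^ 2 • (x₂ * (x₄ * z)) := by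
    rw [← mul_assoc, h₄₂, smul_mul_assoc, mul_assoc]
  rw [h₄₂, h₁₄] at h
  simp only [mul_assoc, mul_smul_comm, smul_mul_assoc, h₁₂', h₃₂', h₄₂', h₁₂, h₁₄, h₃₂,
    smul_add, smul_smul, mul_add, add_mul] at h
  have hrs : r * s ≠ 0 := mul_ne_zero hr hs
  have key : (r * s) • (x₃ * x₄ - s ^ 2 • (x₄ * x₃)) = 0 := by
    rw [← sub_eq_zero] at h
    rw [← h]
    module
  rwa [smul_eq_zero_iff_right hrs, sub_eq_zero] at key

end RootVectors

variable {r s : ℂ}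

theorem k₁_mul_k₂ : (k₁ r s : UCheck r s) * k₂ r s = k₂ r s * k₁ r s := by
  have h := mk_eq_of_rel (Rel.k₁_k₂ (r := r) (s := s))
  simp only [map_mul] at h
  exact h

theorem k₁_mul_e₁ : (k₁ r s : UCheck r s) * e₁ r s = (s ^ 2)⁻¹ • (e₁ r s * k₁ r s) := by
  have h := mk_eq_of_rel (Rel.k₁_e₁ (r := r) (s := s))
  simp only [map_smul, map_mul] at h
  exact h

theorem k₁_mul_e₂ : (k₁ r s : UCheck r s) * e₂ r s = (r * s) • (e₂ r s * k₁ r s) := by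
  have h := mk_eq_of_rel (Rel.k₁_e₂ (r := r) (s := s))
  simp only [map_smul, map_mul] at h
  exact h

theorem k₂_mul_e₁ : (k₂ r s : UCheck r s) * e₁ r s = (r⁻¹ * s⁻¹) • (e₁ r s * k₂ r s) := by
  have h := mk_eq_of_rel (Rel.k₂_e₁ (r := r) (s := s))
  simp only [map_smul, map_mul] at h
  exact h

theorem k₂_mul_e₂ : (k₂ r s : UCheck r s) * e₂ r s = r • (e₂ r s * k₂ r s) := by
  have h := mk_eq_of_rel (Rel.k₂_e₂ (r := r) (s := s))
  simp only [map_smul, map_mul] at h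
  exact h

theorem serre₁ : e₁ r s ^ 2 * e₂ r s - (r ^ 2 + s ^ 2) • (e₁ r s * e₂ r s * e₁ r s)
    + (r ^ 2 * s ^ 2) • (e₂ r s * e₁ r s ^ 2) = 0 := by
  have h := mk_eq_of_rel (Rel.serre₁ (r := r) (s := s))
  simp only [map_add, map_sub, map_smul, map_mul, map_pow, map_zero] at h
  exact h

theorem serre₂ : e₁ r s * e₂ r s ^ 3 - (r ^ 2 + r * s + s ^ 2) • (e₂ r s * e₁ r s * e₂ r s ^ 2)
    + (r * s * (r ^ 2 + r * s + s ^ 2)) • (e₂ r s ^ 2 * e₁ r s * e₂ r s)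
    - (r ^ 3 * s ^ 3) • (e₂ r s ^ 3 * e₁ r s) = 0 := by
  have h := mk_eq_of_rel (Rel.serre₂ (r := r) (s := s))
  simp only [map_add, map_sub, map_smul, map_mul, map_pow, map_zero] at h
  exact h

noncomputable section

/-- The root vector `e₁ e₂ - r² e₂ e₁`. -/
def e₃ (r s : ℂ) : UCheck r s := e₁ r s * e₂ r s - r ^ 2 • (e₂ r s * e₁ r s)

/-- The root vector `e₃ e₂ - rs e₂ e₃`. -/
def e₄ (r s : ℂ) : UCheck r s := e₃ r s * e₂ r s - (r * s) • (e₂ r s * e₃ r s)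

end

theorem e₁_mul_e₂ : e₁ r s * e₂ r s = r ^ 2 • (e₂ r s * e₁ r s) + e₃ r s := by
  rw [e₃]; abel

theorem e₃_mul_e₂ : e₃ r s * e₂ r s = (r * s) • (e₂ r s * e₃ r s) + e₄ r s := by
  rw [e₄]; abel

/-- With `L`, `R` the commuting left and right multiplications by `e₁`, the first Serre relation is
`(L - s² R)(L - r² R) e₂ = 0`, and the inner factor gives `e₃`. -/
theorem e₁_mul_e₃ : e₁ r s * e₃ r s = s ^ 2 • (e₃ r s * e₁ r s) := by
  rw [← sub_eq_zero, ← serre₁ (r := r) (s := s), e₃]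
  simp only [mul_sub, sub_mul, mul_assoc, mul_smul_comm, smul_mul_assoc, smul_sub, smul_smul,
    pow_succ, pow_zero, one_mul]
  module

/-- With `L`, `R` now the multiplications by `e₂`, the second Serre relation is `(R - s² L)(R - rs
L)(R - r² L) e₁ = 0`; the two inner factors give `e₄`. -/
theorem e₄_mul_e₂ : e₄ r s * e₂ r s = s ^ 2 • (e₂ r s * e₄ r s) := by
  rw [← sub_eq_zero, ← serre₂ (r := r) (s := s), e₄, e₃]
  simp only [mul_sub, sub_mul, mul_assoc, mul_smul_comm, smul_mul_assoc, smul_sub, smul_smul,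
    pow_succ, pow_zero, one_mul]
  module

theorem e₁_mul_e₄ : e₁ r s * e₄ r s =
    (r ^ 2 * s ^ 2) • (e₄ r s * e₁ r s) + (s ^ 2 - r * s) • (e₃ r s * e₃ r s) :=
  root_mul_left e₁_mul_e₂ e₁_mul_e₃ e₃_mul_e₂

theorem e₃_mul_e₄ (hr : r ≠ 0) (hs : s ≠ 0) : e₃ r s * e₄ r s = s ^ 2 • (e₄ r s * e₃ r s) :=
  root_mul_root hr hs e₁_mul_e₂ e₁_mul_e₃ e₃_mul_e₂ e₄_mul_e₂

/-! ### Ordered monomials span. -/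

section PBW

theorem mul_unit_of_unit_mul {A : Type*} [Ring A] [Algebra ℂ A] {k : Aˣ} {x : A} {c : ℂ}
    (hc : c ≠ 0) (h : (k : A) * x = c • (x * k)) : x * k = (c⁻¹ • (k : A)) * x := by
  rw [smul_mul_assoc, h, smul_smul, inv_mul_cancel₀ hc, one_smul]

theorem mul_unit_inv_of_unit_mul {A : Type*} [Ring A] [Algebra ℂ A] {k : Aˣ} {x : A} {c : ℂ}
    (h : (k : A) * x = c • (x * k)) : x * ↑k⁻¹ = (c • (↑k⁻¹ : A)) * x := by
  rw [← Units.mul_right_inj k, smul_mul_assoc, mul_smul_comm, ← mul_assoc, h, smul_mul_assoc,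
    mul_assoc, Units.mul_inv, mul_one, ← mul_assoc, Units.mul_inv, one_mul]

theorem unit_mul_mul {A : Type*} [Ring A] [Algebra ℂ A] {k x y : A} {c d : ℂ}
    (hx : k * x = c • (x * k)) (hy : k * y = d • (y * k)) :
    k * (x * y) = (c * d) • (x * y * k) := by
  rw [← mul_assoc, hx, smul_mul_assoc, mul_assoc, hy, mul_smul_comm, smul_smul, mul_assoc]

theorem unit_mul_commutator {A : Type*} [Ring A] [Algebra ℂ A] {k x y : A} {c d : ℂ} (e : ℂ)
    (hx : k * x = c • (x * k)) (hy : k * y = d • (y * k)) :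
    k * (x * y - e • (y * x)) = (c * d) • ((x * y - e • (y * x)) * k) := by
  rw [mul_sub, mul_smul_comm, unit_mul_mul hx hy, unit_mul_mul hy hx, sub_mul, smul_sub,
    smul_mul_assoc, smul_comm e, mul_comm d]

/-- The generators of the torus part. -/
def torusGens (r s : ℂ) : Set (UCheck r s) :=
  {(k₁ r s : UCheck r s), ↑(k₁ r s)⁻¹, (k₂ r s : UCheck r s), ↑(k₂ r s)⁻¹}

theorem kpow_zero_zero : kpow r s 0 0 = 1 := by simp [kpow]

theorem k_comm : k₁ r s * k₂ r s = k₂ r s * k₁ r s := Units.ext k₁_mul_k₂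

theorem kpow_mul_kpow (m n m' n' : ℤ) :
    kpow r s m n * kpow r s m' n' = kpow r s (m + m') (n + n') := by
  rw [kpow, kpow, kpow, ← Units.val_mul]
  congr 1
  have h : Commute (k₂ r s ^ n) (k₁ r s ^ m') := (Commute.symm k_comm).zpow_zpow n m'
  rw [zpow_add, zpow_add, mul_assoc, ← mul_assoc (k₂ r s ^ n), h.eq]
  simp only [mul_assoc]

theorem k₁_eq_kpow : (k₁ r s : UCheck r s) = kpow r s 1 0 := by simp [kpow]

theorem k₂_eq_kpow : (k₂ r s : UCheck r s) = kpow r s 0 1 := by simp [kpow]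

theorem mem_span_kpow_of_mem_adjoin {b : UCheck r s} (hb : b ∈ Algebra.adjoin ℂ (torusGens r s)) :
    b ∈ Submodule.span ℂ (Set.range fun p : ℤ × ℤ => kpow r s p.1 p.2) := by
  have h1 : (1 : UCheck r s) ∈ Submodule.span ℂ (Set.range fun p : ℤ × ℤ => kpow r s p.1 p.2) :=
    Submodule.subset_span ⟨(0, 0), kpow_zero_zero⟩
  refine mem_of_mem_adjoin _ h1 ?_ hb
  intro y hy z hz
  have hy' : ∃ m n : ℤ, y = kpow r s m n := by
    rcases hy with rfl | rfl | rfl | rfl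
    · exact ⟨1, 0, k₁_eq_kpow⟩
    · exact ⟨-1, 0, by simp [kpow]⟩
    · exact ⟨0, 1, k₂_eq_kpow⟩
    · exact ⟨0, -1, by simp [kpow]⟩
  obtain ⟨m, n, rfl⟩ := hy'
  induction hz using Submodule.span_induction with
  | mem z hz =>
    obtain ⟨p, rfl⟩ := hz
    exact Submodule.subset_span ⟨(m + p.1, n + p.2), (kpow_mul_kpow _ _ _ _).symm⟩
  | zero => rw [mul_zero]; exact zero_mem _
  | add z w _ _ hz hw => rw [mul_add]; exact add_mem hz hw
  | smul c z _ hz => rw [mul_smul_comm]; exact Submodule.smul_mem _ c hz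

theorem mul_torusGens {g : Set (UCheck r s)} (hg : torusGens r s ⊆ g) {x : UCheck r s} {c d : ℂ}
    (hc : c ≠ 0) (hd : d ≠ 0) (h₁ : (k₁ r s : UCheck r s) * x = c • (x * k₁ r s))
    (h₂ : (k₂ r s : UCheck r s) * x = d • (x * k₂ r s)) {y : UCheck r s}
    (hy : y ∈ torusGens r s) :
    ∃ b ∈ Algebra.adjoin ℂ g, ∃ c ∈ Algebra.adjoin ℂ g, x * y = b * x + c := by
  have key : ∃ e : ℂ, x * y = (e • y) * x := by
    rcases hy with rfl | rfl | rfl | rfl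
    · exact ⟨_, mul_unit_of_unit_mul hc h₁⟩
    · exact ⟨_, mul_unit_inv_of_unit_mul h₁⟩
    · exact ⟨_, mul_unit_of_unit_mul hd h₂⟩
    · exact ⟨_, mul_unit_inv_of_unit_mul h₂⟩
  obtain ⟨e, he⟩ := key
  exact ⟨e • y, Subalgebra.smul_mem _ (Algebra.subset_adjoin (hg hy)) e, 0, zero_mem _,
    by rw [he, add_zero]⟩

theorem adjoin_eq_top : Algebra.adjoin ℂ
    (insert (e₁ r s) (insert (e₃ r s) (insert (e₄ r s) (insert (e₂ r s) (torusGens r s))))) = ⊤ := by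
  rw [eq_top_iff]
  rintro x -
  obtain ⟨y, rfl⟩ : ∃ y, mk r s y = x := RingQuot.mkAlgHom_surjective ℂ (Rel r s) x
  induction y using FreeAlgebra.induction with
  | grade0 c => rw [AlgHom.commutes]; exact Subalgebra.algebraMap_mem _ c
  | add a b ha hb => rw [map_add]; exact add_mem ha hb
  | mul a b ha hb => rw [map_mul]; exact mul_mem ha hb
  | grade1 g =>
    apply Algebra.subset_adjoin
    cases g with
    | e₁ => exact Or.inl rfl
    | e₂ => exact Or.inr (Or.inr (Or.inr (Or.inl rfl)))
    | k₁ => exact Or.inr (Or.inr (Or.inr (Or.inr (Or.inl rfl))))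
    | k₁inv => exact Or.inr (Or.inr (Or.inr (Or.inr (Or.inr (Or.inl rfl)))))
    | k₂ => exact Or.inr (Or.inr (Or.inr (Or.inr (Or.inr (Or.inr (Or.inl rfl))))))
    | k₂inv => exact Or.inr (Or.inr (Or.inr (Or.inr (Or.inr (Or.inr (Or.inr rfl))))))

/-- The ordered monomials `k₁ᵐ k₂ⁿ e₂ᵃ e₄ᵇ e₃ᶜ e₁ᵈ`. -/
noncomputable def pbw (r s : ℂ) (p : ((((ℤ × ℤ) × ℕ) × ℕ) × ℕ) × ℕ) : UCheck r s :=
  kpow r s p.1.1.1.1.1 p.1.1.1.1.2 * e₂ r s ^ p.1.1.1.2 * e₄ r s ^ p.1.1.2 * e₃ r s ^ p.1.2 *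
    e₁ r s ^ p.2

/-- Adjoining `e₂`, `e₄`, `e₃`, `e₁` to the torus in this order, each new element straightens past
the earlier ones with a remainder among them. -/
theorem mem_span_pbw (hr : r ≠ 0) (hs : s ≠ 0) (x : UCheck r s) :
    x ∈ Submodule.span ℂ (Set.range (pbw r s)) := by
  have k₁e₃ := unit_mul_commutator (r ^ 2) (k₁_mul_e₁ (r := r) (s := s)) k₁_mul_e₂
  have k₂e₃ := unit_mul_commutator (r ^ 2) (k₂_mul_e₁ (r := r) (s := s)) k₂_mul_e₂
  have k₁e₄ := unit_mul_commutator (r * s) k₁e₃ k₁_mul_e₂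
  have k₂e₄ := unit_mul_commutator (r * s) k₂e₃ k₂_mul_e₂
  set g₀ := torusGens r s with hg₀
  set g₂ := insert (e₂ r s) g₀ with hg₂
  set g₄ := insert (e₄ r s) g₂ with hg₄
  set g₃ := insert (e₃ r s) g₄ with hg₃
  have i₂ : g₀ ⊆ g₂ := Set.subset_insert _ _
  have i₄ : g₂ ⊆ g₄ := Set.subset_insert _ _
  have i₃ : g₄ ⊆ g₃ := Set.subset_insert _ _
  have m₂ : e₂ r s ∈ Algebra.adjoin ℂ g₂ := Algebra.subset_adjoin (Set.mem_insert _ _)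
  have m₄ : e₄ r s ∈ Algebra.adjoin ℂ g₄ := Algebra.subset_adjoin (Set.mem_insert _ _)
  have m₃ : e₃ r s ∈ Algebra.adjoin ℂ g₃ := Algebra.subset_adjoin (Set.mem_insert _ _)
  have m₂₄ := Algebra.adjoin_mono (R := ℂ) i₄ m₂
  have m₂₃ := Algebra.adjoin_mono (R := ℂ) i₃ m₂₄
  have m₄₃ := Algebra.adjoin_mono (R := ℂ) i₃ m₄
  have x₂ : ∀ y ∈ g₀, ∃ b ∈ Algebra.adjoin ℂ g₀, ∃ c ∈ Algebra.adjoin ℂ g₀,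
      e₂ r s * y = b * e₂ r s + c := fun y hy =>
    mul_torusGens subset_rfl (by positivity) hr k₁_mul_e₂ k₂_mul_e₂ hy
  have x₄ : ∀ y ∈ g₂, ∃ b ∈ Algebra.adjoin ℂ g₂, ∃ c ∈ Algebra.adjoin ℂ g₂,
      e₄ r s * y = b * e₄ r s + c := by
    rintro y (rfl | hy)
    · exact ⟨_, Subalgebra.smul_mem _ m₂ (s ^ 2), 0, zero_mem _,
        by rw [e₄_mul_e₂, smul_mul_assoc, add_zero]⟩
    · exact mul_torusGens i₂ (by positivity) (by positivity) k₁e₄ k₂e₄ hy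
  have x₃ : ∀ y ∈ g₄, ∃ b ∈ Algebra.adjoin ℂ g₄, ∃ c ∈ Algebra.adjoin ℂ g₄,
      e₃ r s * y = b * e₃ r s + c := by
    rintro y (rfl | rfl | hy)
    · exact ⟨_, Subalgebra.smul_mem _ m₄ (s ^ 2), 0, zero_mem _,
        by rw [e₃_mul_e₄ hr hs, smul_mul_assoc, add_zero]⟩
    · exact ⟨_, Subalgebra.smul_mem _ m₂₄ (r * s), _, m₄, by rw [e₃_mul_e₂, smul_mul_assoc]⟩
    · exact mul_torusGens (i₂.trans i₄) (by positivity) (by positivity) k₁e₃ k₂e₃ hy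
  have x₁ : ∀ y ∈ g₃, ∃ b ∈ Algebra.adjoin ℂ g₃, ∃ c ∈ Algebra.adjoin ℂ g₃,
      e₁ r s * y = b * e₁ r s + c := by
    rintro y (rfl | rfl | rfl | hy)
    · exact ⟨_, Subalgebra.smul_mem _ m₃ (s ^ 2), 0, zero_mem _,
        by rw [e₁_mul_e₃, smul_mul_assoc, add_zero]⟩
    · exact ⟨_, Subalgebra.smul_mem _ m₄₃ (r ^ 2 * s ^ 2), _,
        Subalgebra.smul_mem _ (mul_mem m₃ m₃) (s ^ 2 - r * s), by rw [e₁_mul_e₄, smul_mul_assoc]⟩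
    · exact ⟨_, Subalgebra.smul_mem _ m₂₃ (r ^ 2), _, m₃, by rw [e₁_mul_e₂, smul_mul_assoc]⟩
    · exact mul_torusGens (i₂.trans (i₄.trans i₃)) (by positivity) (by positivity)
        k₁_mul_e₁ k₂_mul_e₁ hy
  exact mem_span_of_mem_adjoin_insert (fun _ => mem_span_of_mem_adjoin_insert
    (fun _ => mem_span_of_mem_adjoin_insert (fun _ => mem_span_of_mem_adjoin_insert
      (fun _ => mem_span_kpow_of_mem_adjoin) x₂) x₄) x₃) x₁
    (by rw [adjoin_eq_top]; exact Algebra.mem_top)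

end PBW

/-! ### The quantum torus and the images of the generators. -/

open TwistedAlgebra

noncomputable section

/-- The exponent group of the quantum torus, with its lexicographic order. -/
abbrev Expo : Type := Lex (Fin 6 → ℤ)

/-- The exponent vector with the given entries. -/
def vec (a b c x m n : ℤ) : Expo := toLex ![a, b, c, x, m, n]

/-- The coordinates of an exponent vector. -/
def crd (i : Fin 6) : Expo →+ ℤ where
  toFun α := ofLex α i
  map_zero' := rfl
  map_add' _ _ := rfl

theorem vec_add (a b c x m n a' b' c' x' m' n' : ℤ) : vec a b c x m n + vec a' b' c' x' m' n' =
    vec (a + a') (b + b') (c + c') (x + x') (m + m') (n + n') := by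
  apply ofLex.injective
  funext i
  fin_cases i <;> rfl

theorem vec_zero : vec 0 0 0 0 0 0 = 0 := by
  apply ofLex.injective
  funext i
  fin_cases i <;> rfl

section crd

variable (a b c x m n : ℤ)

@[simp] theorem crd_zero_vec : crd 0 (vec a b c x m n) = a := rfl
@[simp] theorem crd_one_vec : crd 1 (vec a b c x m n) = b := rfl
@[simp] theorem crd_two_vec : crd 2 (vec a b c x m n) = c := rfl
@[simp] theorem crd_three_vec : crd 3 (vec a b c x m n) = x := rfl
@[simp] theorem crd_four_vec : crd 4 (vec a b c x m n) = m := rfl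
@[simp] theorem crd_five_vec : crd 5 (vec a b c x m n) = n := rfl

end crd

theorem vec_lt_of_zero {a b c x m n a' b' c' x' m' n' : ℤ} (h : a < a') :
    vec a b c x m n < vec a' b' c' x' m' n' :=
  ⟨0, fun j hj => absurd hj (Fin.not_lt_zero j), h⟩

theorem vec_lt_of_one {a b c x m n b' c' x' m' n' : ℤ} (h : b < b') :
    vec a b c x m n < vec a b' c' x' m' n' := by
  refine ⟨1, fun j hj => ?_, h⟩
  obtain rfl : j = 0 := by omega
  rfl

/-- The exponent of `r` in the commutation factors. -/
def rExp (α β : Expo) : ℤ :=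
  2 * crd 0 α * crd 3 β + crd 1 α * crd 3 β
    + 2 * (crd 1 α * crd 0 β + crd 2 α * crd 1 β + crd 2 α * crd 0 β)
    + (crd 0 α + crd 1 α + crd 2 α) * crd 5 β - crd 3 α * crd 4 β - crd 3 α * crd 5 β

/-- The exponent of `s` in the commutation factors. -/
def sExp (α β : Expo) : ℤ :=
  crd 1 α * crd 3 β + 2 * crd 2 α * crd 3 β
    - 2 * (crd 1 α * crd 0 β + crd 2 α * crd 1 β + crd 2 α * crd 0 β)
    + 2 * (crd 0 α + crd 1 α + crd 2 α) * crd 4 β + (crd 0 α + crd 1 α + crd 2 α) * crd 5 β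
    - crd 3 α * crd 4 β

variable {r s : ℂ} (hr : r ≠ 0) (hs : s ≠ 0)

/-- The bicharacter of the quantum torus into which `Ǔ` embeds. -/
def bichar : Bichar ℂ Expo where
  toFun α β := r ^ rExp α β * s ^ sExp α β
  ne_zero α β := mul_ne_zero (zpow_ne_zero _ hr) (zpow_ne_zero _ hs)
  add_left α β γ := by
    have h₁ : rExp (α + β) γ = rExp α γ + rExp β γ := by simp only [rExp, map_add]; ring
    have h₂ : sExp (α + β) γ = sExp α γ + sExp β γ := by simp only [sExp, map_add]; ring
    rw [h₁, h₂, zpow_add₀ hr, zpow_add₀ hs]; ring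
  add_right α β γ := by
    have h₁ : rExp α (β + γ) = rExp α β + rExp α γ := by simp only [rExp, map_add]; ring
    have h₂ : sExp α (β + γ) = sExp α β + sExp α γ := by simp only [sExp, map_add]; ring
    rw [h₁, h₂, zpow_add₀ hr, zpow_add₀ hs]; ring

/-- The quantum torus. -/
abbrev QTorus : Type := TwistedAlgebra (bichar hr hs)

/-- The basis monomials of the quantum torus. -/
def xpow (a b c x m n : ℤ) : QTorus hr hs := mono (bichar hr hs) (vec a b c x m n) 1

theorem xpow_mul_xpow (a b c x m n a' b' c' x' m' n' : ℤ) :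
    xpow hr hs a b c x m n * xpow hr hs a' b' c' x' m' n' =
    (r ^ (2 * a * x' + b * x' + 2 * (b * a' + c * b' + c * a') + (a + b + c) * n' - x * m' - x * n')
      * s ^ (b * x' + 2 * c * x' - 2 * (b * a' + c * b' + c * a') + 2 * (a + b + c) * m'
        + (a + b + c) * n' - x * m')) •
    xpow hr hs (a + a') (b + b') (c + c') (x + x') (m + m') (n + n') := by
  simp only [xpow, smul_mono, mono_mul_mono, vec_add, one_mul, mul_one]
  rfl

theorem xpow_zero : xpow hr hs 0 0 0 0 0 0 = 1 := by rw [xpow, vec_zero]; rfl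

/-- The coefficient of the last monomial in the image of `e₁`. -/
def lastCoeff (r s : ℂ) : ℂ := s ^ 3 / (r * (r + s) ^ 2)

/-- The images of the generators in the quantum torus. -/
def genImage : Gen → QTorus hr hs
  | .e₁ => xpow hr hs 1 0 0 0 0 0 + xpow hr hs 0 1 0 0 0 0 + xpow hr hs 0 0 1 0 0 0
      + lastCoeff r s • xpow hr hs (-1) 2 0 0 0 0
  | .e₂ => xpow hr hs 0 0 0 1 0 0
  | .k₁ => xpow hr hs 0 0 0 0 1 0
  | .k₁inv => xpow hr hs 0 0 0 0 (-1) 0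
  | .k₂ => xpow hr hs 0 0 0 0 0 1
  | .k₂inv => xpow hr hs 0 0 0 0 0 (-1)

/-- Write `t y = q y t` for a monomial `t` of the image of `e₁` and `y` the image of `e₂`. The four
monomials have `q = r², rs, s², s²`. -/
theorem genImage_rel (h : r + s ≠ 0) ⦃x y : FreeAlgebra ℂ Gen⦄ (hxy : Rel r s x y) :
    FreeAlgebra.lift ℂ (genImage hr hs) x = FreeAlgebra.lift ℂ (genImage hr hs) y := by
  induction hxy <;>
  simp only [map_mul, map_one, map_smul, map_sub, map_add, map_pow, map_zero,
    FreeAlgebra.lift_ι_apply, genImage]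
  case k₁_mul_inv => rw [xpow_mul_xpow]; norm_num [xpow_zero]
  case k₁_inv_mul => rw [xpow_mul_xpow]; norm_num [xpow_zero]
  case k₂_mul_inv => rw [xpow_mul_xpow]; norm_num [xpow_zero]
  case k₂_inv_mul => rw [xpow_mul_xpow]; norm_num [xpow_zero]
  case k₁_k₂ => rw [xpow_mul_xpow, xpow_mul_xpow]; norm_num
  case k₁_e₁ =>
    simp only [mul_add, add_mul, mul_smul_comm, smul_mul_assoc, xpow_mul_xpow, smul_smul, smul_add]
    norm_num
    match_scalars <;> field_simp
  case k₁_e₂ =>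
    simp only [xpow_mul_xpow, smul_smul]
    norm_num
    match_scalars
    field_simp
  case k₂_e₁ =>
    simp only [mul_add, add_mul, mul_smul_comm, smul_mul_assoc, xpow_mul_xpow, smul_smul, smul_add]
    norm_num
    match_scalars <;> field_simp
  case k₂_e₂ =>
    simp only [xpow_mul_xpow, smul_smul]
    norm_num
    match_scalars
    field_simp
  -- A single monomial contributes `(q - r²)(q - s²)`, nonzero only for the second. Its square is
  -- cancelled by the cross terms of the first and last monomials, which fixes `lastCoeff`.
  case serre₁ =>
    simp only [pow_succ, pow_zero, one_mul,
      mul_add, add_mul, mul_smul_comm, smul_mul_assoc, xpow_mul_xpow, smul_smul, smul_add]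
    norm_num [lastCoeff]
    match_scalars <;> field_simp <;> ring
  -- The relation is linear in `e₁` and each monomial contributes `(q - r²)(q - rs)(q - s²) = 0`, so
  -- the value of `lastCoeff` plays no role.
  case serre₂ =>
    simp only [pow_succ, pow_zero, one_mul,
      mul_add, add_mul, mul_smul_comm, smul_mul_assoc, xpow_mul_xpow, smul_smul, smul_add]
    norm_num
    match_scalars <;> field_simp <;> ring

end

/-! ### Injectivity of the embedding, and the weight grading. -/

open TwistedAlgebra

noncomputable section

variable {r s : ℂ} (hr : r ≠ 0) (hs : s ≠ 0) (h : r + s ≠ 0)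

/-- The homomorphism from `Ǔ` to the quantum torus. -/
def torusHom : UCheck r s →ₐ[ℂ] QTorus hr hs :=
  RingQuot.liftAlgHom ℂ ⟨FreeAlgebra.lift ℂ (genImage hr hs), genImage_rel hr hs h⟩

theorem torusHom_mk (g : Gen) : torusHom hr hs h (mk r s (.ι ℂ g)) = genImage hr hs g := by
  have := RingQuot.liftAlgHom_mkAlgHom_apply ℂ (FreeAlgebra.lift ℂ (genImage hr hs))
    (genImage_rel hr hs h) (.ι ℂ g)
  rw [FreeAlgebra.lift_ι_apply] at this
  exact this

theorem torusHom_e₁ : torusHom hr hs h (e₁ r s) =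
    xpow hr hs 1 0 0 0 0 0 + xpow hr hs 0 1 0 0 0 0 + xpow hr hs 0 0 1 0 0 0
      + lastCoeff r s • xpow hr hs (-1) 2 0 0 0 0 := torusHom_mk hr hs h Gen.e₁

theorem torusHom_e₂ : torusHom hr hs h (e₂ r s) = xpow hr hs 0 0 0 1 0 0 :=
  torusHom_mk hr hs h Gen.e₂

/-- The twisted commutator with factor `r²` kills the leading monomial of `e₁`; the one with factor
`rs` defining `e₄` kills the next. This makes the leading exponents triangular. -/
theorem torusHom_e₃ : torusHom hr hs h (e₃ r s) =
    (r * s - r ^ 2) • xpow hr hs 0 1 0 1 0 0 + (s ^ 2 - r ^ 2) • xpow hr hs 0 0 1 1 0 0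
      + ((s ^ 2 - r ^ 2) * lastCoeff r s) • xpow hr hs (-1) 2 0 1 0 0 := by
  rw [e₃, map_sub, map_smul, map_mul, map_mul, torusHom_e₁, torusHom_e₂]
  simp only [mul_add, add_mul, mul_smul_comm, smul_mul_assoc, xpow_mul_xpow, smul_smul, smul_add]
  norm_num
  match_scalars <;> field_simp
  ring

theorem torusHom_e₄ : torusHom hr hs h (e₄ r s) =
    ((s ^ 2 - r * s) * (s ^ 2 - r ^ 2)) • xpow hr hs 0 0 1 2 0 0
      + ((s ^ 2 - r * s) * (s ^ 2 - r ^ 2) * lastCoeff r s) • xpow hr hs (-1) 2 0 2 0 0 := by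
  rw [e₄, map_sub, map_smul, map_mul, map_mul, torusHom_e₃, torusHom_e₂]
  simp only [mul_add, add_mul, mul_smul_comm, smul_mul_assoc, xpow_mul_xpow, smul_smul, smul_add]
  norm_num
  match_scalars <;> field_simp
  ring

theorem torusHom_kpow (m n : ℤ) : torusHom hr hs h (kpow r s m n) = xpow hr hs 0 0 0 0 m n := by
  have add (m n m' n' : ℤ)
      (h₁ : torusHom hr hs h (kpow r s m n) = xpow hr hs 0 0 0 0 m n)
      (h₂ : torusHom hr hs h (kpow r s m' n') = xpow hr hs 0 0 0 0 m' n') :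
      torusHom hr hs h (kpow r s (m + m') (n + n')) = xpow hr hs 0 0 0 0 (m + m') (n + n') := by
    rw [← kpow_mul_kpow, map_mul, h₁, h₂, xpow_mul_xpow]
    norm_num
  have h₁ : torusHom hr hs h (kpow r s 1 0) = xpow hr hs 0 0 0 0 1 0 := by
    rw [← k₁_eq_kpow]; exact torusHom_mk hr hs h Gen.k₁
  have h₂ : torusHom hr hs h (kpow r s 0 1) = xpow hr hs 0 0 0 0 0 1 := by
    rw [← k₂_eq_kpow]; exact torusHom_mk hr hs h Gen.k₂
  have h₁' : torusHom hr hs h (kpow r s (-1) 0) = xpow hr hs 0 0 0 0 (-1) 0 := by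
    rw [show kpow r s (-1) 0 = mk r s (.ι ℂ Gen.k₁inv) by simp [kpow]; rfl]
    exact torusHom_mk hr hs h Gen.k₁inv
  have h₂' : torusHom hr hs h (kpow r s 0 (-1)) = xpow hr hs 0 0 0 0 0 (-1) := by
    rw [show kpow r s 0 (-1) = mk r s (.ι ℂ Gen.k₂inv) by simp [kpow]; rfl]
    exact torusHom_mk hr hs h Gen.k₂inv
  have h₀ : torusHom hr hs h (kpow r s 0 0) = xpow hr hs 0 0 0 0 0 0 := by
    rw [kpow_zero_zero, map_one, xpow_zero]
  induction m with
  | zero =>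
    induction n with
    | zero => exact h₀
    | succ n ih => simpa using add _ _ _ _ ih h₂
    | pred n ih => simpa [sub_eq_add_neg] using add _ _ _ _ ih h₂'
  | succ m ih => simpa using add _ _ _ _ ih h₁
  | pred m ih => simpa [sub_eq_add_neg] using add _ _ _ _ ih h₁'

theorem smul_xpow (a b c x m n : ℤ) (d : ℂ) :
    d • xpow hr hs a b c x m n = mono (bichar hr hs) (vec a b c x m n) d := by
  rw [xpow, smul_mono, mul_one]

theorem isLead_e₁ : IsLead (torusHom hr hs h (e₁ r s)) (vec 1 0 0 0 0 0) := by
  rw [torusHom_e₁, smul_xpow]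
  exact (((isLead_mono _ one_ne_zero).add_mono (vec_lt_of_zero (by norm_num)) _).add_mono
    (vec_lt_of_zero (by norm_num)) _).add_mono (vec_lt_of_zero (by norm_num)) _

theorem isLead_e₂ : IsLead (torusHom hr hs h (e₂ r s)) (vec 0 0 0 1 0 0) := by
  rw [torusHom_e₂]
  exact isLead_mono _ one_ne_zero

theorem isLead_e₃ (h' : r ≠ s) : IsLead (torusHom hr hs h (e₃ r s)) (vec 0 1 0 1 0 0) := by
  rw [torusHom_e₃]
  simp only [smul_xpow]
  refine ((isLead_mono _ ?_).add_mono (vec_lt_of_one (by norm_num)) _).add_mono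
    (vec_lt_of_zero (by norm_num)) _
  rw [show r * s - r ^ 2 = r * (s - r) by ring]
  exact mul_ne_zero hr (sub_ne_zero.2 h'.symm)

theorem isLead_e₄ (h' : r ≠ s) : IsLead (torusHom hr hs h (e₄ r s)) (vec 0 0 1 2 0 0) := by
  rw [torusHom_e₄]
  simp only [smul_xpow]
  refine (isLead_mono _ ?_).add_mono (vec_lt_of_zero (by norm_num)) _
  rw [show (s ^ 2 - r * s) * (s ^ 2 - r ^ 2) = s * (s - r) ^ 2 * (r + s) by ring]
  exact mul_ne_zero (mul_ne_zero hs (pow_ne_zero 2 (sub_ne_zero.2 h'.symm))) h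

/-- The leading exponent of an ordered monomial. -/
def pbwLead (p : ((((ℤ × ℤ) × ℕ) × ℕ) × ℕ) × ℕ) : Expo :=
  vec 0 0 0 0 p.1.1.1.1.1 p.1.1.1.1.2 + p.1.1.1.2 • vec 0 0 0 1 0 0 + p.1.1.2 • vec 0 0 1 2 0 0
    + p.1.2 • vec 0 1 0 1 0 0 + p.2 • vec 1 0 0 0 0 0

/-- Coordinates 0, 1, 2 give the powers of `e₁`, `e₃`, `e₄`; coordinate 3 then gives that of `e₂`,
and the last two the torus part. -/
theorem pbwLead_injective : Function.Injective pbwLead := by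
  rintro ⟨⟨⟨⟨⟨m, n⟩, a⟩, b⟩, c⟩, d⟩ ⟨⟨⟨⟨⟨m', n'⟩, a'⟩, b'⟩, c'⟩, d'⟩ heq
  have h₀ := congrArg (crd 0) heq
  have h₁ := congrArg (crd 1) heq
  have h₂ := congrArg (crd 2) heq
  have h₃ := congrArg (crd 3) heq
  have h₄ := congrArg (crd 4) heq
  have h₅ := congrArg (crd 5) heq
  simp only [pbwLead, map_add, map_nsmul, crd_zero_vec, crd_one_vec, crd_two_vec, crd_three_vec,
    crd_four_vec, crd_five_vec] at h₀ h₁ h₂ h₃ h₄ h₅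
  simp only [nsmul_eq_mul, mul_zero, mul_one, add_zero, zero_add] at h₀ h₁ h₂ h₃ h₄ h₅
  simp only [Prod.mk.injEq]
  omega

theorem isLead_pbw (h' : r ≠ s) (p : ((((ℤ × ℤ) × ℕ) × ℕ) × ℕ) × ℕ) :
    IsLead (torusHom hr hs h (pbw r s p)) (pbwLead p) := by
  simp only [pbw, map_mul, map_pow, torusHom_kpow]
  exact ((((isLead_mono _ one_ne_zero).mul ((isLead_e₂ hr hs h).pow _)).mul
    ((isLead_e₄ hr hs h h').pow _)).mul ((isLead_e₃ hr hs h h').pow _)).mul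
    ((isLead_e₁ hr hs h).pow _)

theorem torusHom_injective (h' : r ≠ s) : Function.Injective (torusHom hr hs h) := by
  rw [injective_iff_map_eq_zero]
  intro x hx
  obtain ⟨c, rfl⟩ := Finsupp.mem_span_range_iff_exists_finsupp.1 (mem_span_pbw hr hs x)
  rw [Finsupp.sum, map_sum] at hx
  simp only [map_smul] at hx
  rw [eq_zero_of_sum_eq_zero_of_isLead _ _ pbwLead_injective (isLead_pbw hr hs h h') c hx,
    Finsupp.sum_zero_index]

/-- The weight of an exponent: the degrees in `e₁` and `e₂`. -/
def wt : Expo →+ ℤ × ℤ := (crd 0 + crd 1 + crd 2).prod (crd 3)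

@[simp] theorem wt_vec (a b c x m n : ℤ) : wt (vec a b c x m n) = (a + b + c, x) := rfl

theorem homog_xpow {a b c x m n : ℤ} {w : ℤ × ℤ} (hw : (a + b + c, x) = w) :
    Homog wt w (xpow hr hs a b c x m n) := by
  rw [← hw]; exact homog_mono _ _

theorem homog_e₁ : Homog wt (1, 0) (torusHom hr hs h (e₁ r s)) := by
  rw [torusHom_e₁]
  exact (((homog_xpow hr hs (by norm_num)).add (homog_xpow hr hs (by norm_num))).add (homog_xpow hr hs (by norm_num))).add
    ((homog_xpow hr hs (by norm_num)).smul _)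

theorem homog_e₂ : Homog wt (0, 1) (torusHom hr hs h (e₂ r s)) := by
  rw [torusHom_e₂]
  exact homog_xpow hr hs (by norm_num)

theorem homog_e₃ : Homog wt (1, 1) (torusHom hr hs h (e₃ r s)) := by
  rw [torusHom_e₃]
  exact (((homog_xpow hr hs (by norm_num)).smul _).add ((homog_xpow hr hs (by norm_num)).smul _)).add
    ((homog_xpow hr hs (by norm_num)).smul _)

theorem homog_e₄ : Homog wt (1, 2) (torusHom hr hs h (e₄ r s)) := by
  rw [torusHom_e₄]
  exact ((homog_xpow hr hs (by norm_num)).smul _).add ((homog_xpow hr hs (by norm_num)).smul _)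

/-- The weight of an ordered monomial. -/
def pbwWt (p : ((((ℤ × ℤ) × ℕ) × ℕ) × ℕ) × ℕ) : ℤ × ℤ :=
  (p.1.1.2 + p.1.2 + p.2, p.1.1.1.2 + 2 * p.1.1.2 + p.1.2)

theorem homog_pbw (p : ((((ℤ × ℤ) × ℕ) × ℕ) × ℕ) × ℕ) :
    Homog wt (pbwWt p) (torusHom hr hs h (pbw r s p)) := by
  simp only [pbw, map_mul, map_pow, torusHom_kpow]
  have := ((((homog_xpow hr hs (a := 0) (b := 0) (c := 0) (x := 0) (m := p.1.1.1.1.1)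
    (n := p.1.1.1.1.2) rfl).mul ((homog_e₂ hr hs h).pow p.1.1.1.2)).mul
    ((homog_e₄ hr hs h).pow p.1.1.2)).mul ((homog_e₃ hr hs h).pow p.1.2)).mul
    ((homog_e₁ hr hs h).pow p.2)
  convert this using 1
  ext <;> simp [pbwWt]
  ring

/-- Elements of `Ǔ` have nonnegative weights. -/
theorem wt_nonneg {x : UCheck r s} {α : Expo} (hα : (torusHom hr hs h x).coeff α ≠ 0) :
    0 ≤ (wt α).1 ∧ 0 ≤ (wt α).2 := by
  obtain ⟨c, rfl⟩ := Finsupp.mem_span_range_iff_exists_finsupp.1 (mem_span_pbw hr hs x)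
  rw [Finsupp.sum, map_sum, coeff_sum] at hα
  obtain ⟨p, -, hp⟩ := Finset.exists_ne_zero_of_sum_ne_zero hα
  rw [map_smul, coeff_smul] at hp
  rw [homog_pbw hr hs h p α (right_ne_zero_of_mul hp)]
  constructor <;> simp only [pbwWt] <;> positivity

/-- A homogeneous element is a combination of the ordered monomials of its weight. -/
theorem mem_span_of_homog (h' : r ≠ s) {x : UCheck r s} {w : ℤ × ℤ}
    (hx : Homog wt w (torusHom hr hs h x)) :
    x ∈ Submodule.span ℂ (pbw r s '' {p | pbwWt p = w}) := by
  classical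
  obtain ⟨c, rfl⟩ := Finsupp.mem_span_range_iff_exists_finsupp.1 (mem_span_pbw hr hs x)
  have key : (c.sum fun p a => a • pbw r s p) =
      ∑ p ∈ c.support with pbwWt p = w, c p • pbw r s p := by
    apply torusHom_injective hr hs h h'
    refine ext_coeff fun α => ?_
    by_cases hα : wt α = w
    · rw [map_sum, coeff_sum, Finset.sum_filter, Finsupp.sum, map_sum, coeff_sum]
      refine Finset.sum_congr rfl fun p _ => ?_
      split_ifs with hp
      · rfl
      · rw [map_smul, coeff_smul]
        by_contra hne
        exact hp ((homog_pbw hr hs h p α (right_ne_zero_of_mul hne)).symm.trans hα)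
    · rw [not_imp_comm.1 (hx α) hα, map_sum, coeff_sum]
      refine (Finset.sum_eq_zero fun p hp => ?_).symm
      rw [map_smul, coeff_smul]
      by_contra hne
      exact hα ((homog_pbw hr hs h p α (right_ne_zero_of_mul hne)).trans
        (Finset.mem_filter.1 hp).2)
  rw [key]
  exact Submodule.sum_mem _ fun p hp => Submodule.smul_mem _ _
    (Submodule.subset_span ⟨p, (Finset.mem_filter.1 hp).2, rfl⟩)

/-- The span of the elements `k₁ᵐ k₂ⁿ`. -/
def torusPart (r s : ℂ) : Submodule ℂ (UCheck r s) :=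
  Submodule.span ℂ (Set.range fun p : ℤ × ℤ => kpow r s p.1 p.2)

theorem mem_torusPart_of_homog (h' : r ≠ s) {x : UCheck r s}
    (hx : Homog wt 0 (torusHom hr hs h x)) : x ∈ torusPart r s := by
  refine Submodule.span_mono ?_ (mem_span_of_homog hr hs h h' hx)
  rintro _ ⟨⟨⟨⟨⟨⟨m, n⟩, a⟩, b⟩, c⟩, d⟩, hp, rfl⟩
  simp only [pbwWt, Set.mem_ofPred_eq, Prod.ext_iff, Prod.fst_zero, Prod.snd_zero] at hp
  obtain ⟨rfl, rfl, rfl, rfl⟩ : a = 0 ∧ b = 0 ∧ c = 0 ∧ d = 0 := by omega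
  exact ⟨(m, n), by simp [pbw]⟩

theorem exists_eq_mul_of_homog (h' : r ≠ s) {x y : UCheck r s} {w : ℤ × ℤ}
    (hx : Homog wt w (torusHom hr hs h x))
    (hy : ∀ p, pbwWt p = w → ∃ m n, pbw r s p = kpow r s m n * y) :
    ∃ z, x = z * y := by
  have hx' := mem_span_of_homog hr hs h h' hx
  clear hx
  induction hx' using Submodule.span_induction with
  | mem x hx =>
    obtain ⟨p, hp, rfl⟩ := hx
    obtain ⟨m, n, hmn⟩ := hy p hp
    exact ⟨_, hmn⟩
  | zero => exact ⟨0, (zero_mul y).symm⟩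
  | add x x' _ _ hx hx' =>
    obtain ⟨z, rfl⟩ := hx
    obtain ⟨z', rfl⟩ := hx'
    exact ⟨z + z', (add_mul _ _ _).symm⟩
  | smul c x _ hx =>
    obtain ⟨z, rfl⟩ := hx
    exact ⟨c • z, (smul_mul_assoc _ _ _).symm⟩

/-- All root vectors other than `e₁` have positive degree in `e₂`, so only `e₁` with a torus factor
has this weight. -/
theorem exists_eq_mul_e₁ (h' : r ≠ s) {x : UCheck r s}
    (hx : Homog wt (1, 0) (torusHom hr hs h x)) : ∃ z, x = z * e₁ r s := by
  refine exists_eq_mul_of_homog hr hs h h' hx ?_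
  rintro ⟨⟨⟨⟨⟨m, n⟩, a⟩, b⟩, c⟩, d⟩ hp
  simp only [pbwWt, Prod.ext_iff] at hp
  obtain ⟨rfl, rfl, rfl, rfl⟩ : a = 0 ∧ b = 0 ∧ c = 0 ∧ d = 1 := by omega
  exact ⟨m, n, by simp [pbw]⟩

theorem exists_eq_mul_e₂ (h' : r ≠ s) {x : UCheck r s}
    (hx : Homog wt (0, 1) (torusHom hr hs h x)) : ∃ z, x = z * e₂ r s := by
  refine exists_eq_mul_of_homog hr hs h h' hx ?_
  rintro ⟨⟨⟨⟨⟨m, n⟩, a⟩, b⟩, c⟩, d⟩ hp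
  simp only [pbwWt, Prod.ext_iff] at hp
  obtain ⟨rfl, rfl, rfl, rfl⟩ : a = 1 ∧ b = 0 ∧ c = 0 ∧ d = 0 := by omega
  exact ⟨m, n, by simp [pbw]⟩

end

/-! ### Units, and the constraints on an automorphism. -/

open TwistedAlgebra

section Automorphisms

variable {r s : ℂ} (hr : r ≠ 0) (hs : s ≠ 0) (h : r + s ≠ 0) (h' : r ≠ s)

include hr hs h h' in
theorem mul_eq_zero' {x y : UCheck r s} (hxy : x * y = 0) : x = 0 ∨ y = 0 := by
  by_contra! hne
  have inj := injective_iff_map_eq_zero _ |>.1 (torusHom_injective hr hs h h')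
  refine mul_ne_zero_of_ne_zero (fun h0 => hne.1 (inj _ h0)) (fun h0 => hne.2 (inj _ h0)) ?_
  rw [← map_mul, hxy, map_zero]

theorem eq_vec_of_mem_torusPart {x : UCheck r s} (hx : x ∈ torusPart r s) {α : Expo}
    (hα : (torusHom hr hs h x).coeff α ≠ 0) : ∃ m n, α = vec 0 0 0 0 m n := by
  induction hx using Submodule.span_induction with
  | mem x hx =>
    obtain ⟨p, rfl⟩ := hx
    rw [torusHom_kpow, xpow, coeff_mono] at hα
    exact ⟨p.1, p.2, (by_contra fun hne => hα (if_neg hne) : vec 0 0 0 0 p.1 p.2 = α).symm⟩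
  | zero => exact absurd (by rw [map_zero, coeff_zero]) hα
  | add x y _ _ hx hy =>
    by_cases hxα : (torusHom hr hs h x).coeff α = 0
    · exact hy fun hyα => hα (by rw [map_add, coeff_add, hxα, hyα, add_zero])
    · exact hx hxα
  | smul c x _ hx => exact hx fun h0 => hα (by rw [map_smul, coeff_smul, h0, mul_zero])

include hr hs h h' in
/-- The units of `Ǔ` are the scalar multiples of the `k₁ᵐ k₂ⁿ`. -/
theorem eq_smul_kpow_of_mul_eq_one {x y : UCheck r s} (hxy : x * y = 1) :
    ∃ c : ℂ, c ≠ 0 ∧ ∃ m n : ℤ, x = c • kpow r s m n := by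
  have hφ : torusHom hr hs h x * torusHom hr hs h y = 1 := by rw [← map_mul, hxy, map_one]
  obtain ⟨α, hx, hy, hα⟩ := eq_mono_of_mul_eq_one hφ
  -- Both `α` and `-α` occur as exponents of elements of the algebra, so the weight of `α` vanishes.
  have h₁ := wt_nonneg hr hs h hx
  have h₂ := wt_nonneg hr hs h hy
  rw [map_neg, Prod.fst_neg, Prod.snd_neg] at h₂
  have h₀ : wt α = 0 := Prod.ext (by simp only [Prod.fst_zero]; omega)
    (by simp only [Prod.snd_zero]; omega)
  have hhom : Homog wt 0 (torusHom hr hs h x) := by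
    rw [hα, ← h₀]
    exact homog_mono _ _
  obtain ⟨m, n, hmn⟩ := eq_vec_of_mem_torusPart hr hs h
    (mem_torusPart_of_homog hr hs h h' hhom) hx
  refine ⟨_, hx, m, n, torusHom_injective hr hs h h' ?_⟩
  rw [map_smul, torusHom_kpow, smul_xpow, ← hmn, ← hα]

variable (hrs : ∀ m n : ℤ, r ^ m * s ^ n = 1 → m = 0 ∧ n = 0)

include hrs in
/-- The weights occurring in an eigenvector of conjugation by `k₁ᵐ k₂ⁿ`. -/
theorem weight_of_commutation {x : UCheck r s} {m n p q : ℤ} {c : ℂ} (hc : c ≠ 0)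
    (hx : (c • kpow r s m n) * x = (r ^ p * s ^ q) • (x * (c • kpow r s m n))) {α : Expo}
    (hα : (torusHom hr hs h x).coeff α ≠ 0) :
    p + (wt α).1 * n - (wt α).2 * m - (wt α).2 * n = 0 ∧
      q + 2 * (wt α).1 * m + (wt α).1 * n - (wt α).2 * m = 0 := by
  have h₁ := congrArg (fun z => (torusHom hr hs h z).coeff (vec 0 0 0 0 m n + α)) hx
  simp only [map_mul, map_smul, torusHom_kpow, smul_xpow, coeff_smul] at h₁
  rw [coeff_mono_mul, add_comm (vec 0 0 0 0 m n) α, coeff_mul_mono] at h₁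
  -- The bicharacter is normalised so that torus exponents on the left contribute no factor.
  have h₂ : (bichar hr hs).toFun (vec 0 0 0 0 m n) α = 1 := by
    change r ^ rExp _ _ * s ^ sExp _ _ = 1
    simp [rExp, sExp]
  rw [h₂] at h₁
  have h₃ : r ^ p * s ^ q * (bichar hr hs).toFun α (vec 0 0 0 0 m n) = 1 := by
    have hne := mul_ne_zero hc hα
    refine mul_left_cancel₀ hne ?_
    rw [h₁]
    ring
  have h₄ : (bichar hr hs).toFun α (vec 0 0 0 0 m n) =
      r ^ ((wt α).1 * n - (wt α).2 * m - (wt α).2 * n) *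
        s ^ (2 * (wt α).1 * m + (wt α).1 * n - (wt α).2 * m) := by
    change r ^ rExp _ _ * s ^ sExp _ _ = _
    congr 2 <;> simp [rExp, sExp, wt]
  rw [h₄] at h₃
  have := hrs (p + ((wt α).1 * n - (wt α).2 * m - (wt α).2 * n))
    (q + (2 * (wt α).1 * m + (wt α).1 * n - (wt α).2 * m))
    (by rw [zpow_add₀ hr, zpow_add₀ hs, ← h₃]; ring)
  omega

/-- Here `(i, j)` and `(i', j')` are weights occurring in the images of `e₁`, `e₂`, and `(m₁, n₁)`,
`(m₂, n₂)` the torus exponents of the images of `k₁`, `k₂`. Subtracting the equations in each pair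
gives a matrix product equal to `diag(2, 1)`, so the torus exponents are independent. The remaining
equations then force `j + 2 i' = 0`, and nonnegativity makes both vanish. -/
theorem weight_equations {i j i' j' m₁ n₁ m₂ n₂ : ℤ} (hj : 0 ≤ j) (hi : 0 ≤ i) (hi' : 0 ≤ i')
    (h₁ : 0 + i * n₁ - j * m₁ - j * n₁ = 0 ∧ -2 + 2 * i * m₁ + i * n₁ - j * m₁ = 0)
    (h₂ : -1 + i * n₂ - j * m₂ - j * n₂ = 0 ∧ -1 + 2 * i * m₂ + i * n₂ - j * m₂ = 0)
    (h₃ : 1 + i' * n₁ - j' * m₁ - j' * n₁ = 0 ∧ 1 + 2 * i' * m₁ + i' * n₁ - j' * m₁ = 0)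
    (h₄ : 1 + i' * n₂ - j' * m₂ - j' * n₂ = 0 ∧ 0 + 2 * i' * m₂ + i' * n₂ - j' * m₂ = 0) :
    m₁ = 1 ∧ n₁ = 0 ∧ m₂ = 0 ∧ n₂ = 1 ∧ (i, j) = ((1 : ℤ), (0 : ℤ)) ∧
      (i', j') = ((0 : ℤ), (1 : ℤ)) := by
  have a₁ : 2 * i * m₁ + j * n₁ = 2 := by linarith
  have a₂ : 2 * i * m₂ + j * n₂ = 0 := by linarith
  have a₃ : 2 * i' * m₁ + j' * n₁ = 0 := by linarith
  have a₄ : 2 * i' * m₂ + j' * n₂ = 1 := by linarith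
  have hdet : (2 * i * j' - j * (2 * i')) * (m₁ * n₂ - m₂ * n₁) = 2 := by
    linear_combination (2 * i' * m₂ + j' * n₂) * a₁ + 2 * a₄ - (2 * i' * m₁ + j' * n₁) * a₂
  have hx : (j + 2 * i') * (m₁ * n₂ - m₂ * n₁) = 0 := by
    linear_combination n₂ * a₃ - n₁ * a₄ - n₂ * h₁.1 + n₁ * h₂.1
  rcases mul_eq_zero.1 hx with hx | hx
  · obtain rfl : j = 0 := by omega
    obtain rfl : i' = 0 := by omega
    have e₁ : i * m₁ = 1 := by linarith
    obtain rfl := Int.eq_one_of_mul_eq_one_right hi e₁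
    have f₁ : m₁ = 1 := by linarith
    have f₂ : n₁ = 0 := by linarith [h₁.1]
    have f₃ : m₂ = 0 := by linarith
    have f₄ : n₂ = 1 := by linarith [h₂.1]
    subst f₁ f₂ f₃ f₄
    exact ⟨rfl, rfl, rfl, rfl, rfl, by rw [Prod.mk.injEq]; exact ⟨rfl, by linarith⟩⟩
  · rw [hx, mul_zero] at hdet
    omega

theorem torusHom_ne_zero_of_ne_zero (h' : r ≠ s) {x : UCheck r s} (hx : x ≠ 0) :
    torusHom hr hs h x ≠ 0 :=
  fun h0 => hx ((injective_iff_map_eq_zero _).1 (torusHom_injective hr hs h h') _ h0)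

include hr hs h in
theorem e₁_ne_zero : e₁ r s ≠ 0 :=
  fun h0 => (isLead_e₁ hr hs h).ne_zero (by rw [h0, map_zero])

include hr hs h in
theorem e₂_ne_zero : e₂ r s ≠ 0 :=
  fun h0 => (isLead_e₂ hr hs h).ne_zero (by rw [h0, map_zero])

include hr hs h h' hrs in
-- Units go to units, so the images of `k₁`, `k₂` are scaled torus monomials. Every exponent in the
-- images of `e₁`, `e₂` satisfies the weight equations, hence these images are homogeneous of the
-- original weights.
theorem aut_generators (θ : UCheck r s ≃ₐ[ℂ] UCheck r s) :
    (∃ l : ℂ, l ≠ 0 ∧ θ (k₁ r s : UCheck r s) = l • (k₁ r s : UCheck r s)) ∧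
    (∃ l : ℂ, l ≠ 0 ∧ θ (k₂ r s : UCheck r s) = l • (k₂ r s : UCheck r s)) ∧
    (∃ z, θ (e₁ r s) = z * e₁ r s) ∧
    (∃ z, θ (e₂ r s) = z * e₂ r s) := by
  have hunit (k : (UCheck r s)ˣ) : ∃ c : ℂ, c ≠ 0 ∧ ∃ m n : ℤ, θ (k : UCheck r s) =
      c • kpow r s m n :=
    eq_smul_kpow_of_mul_eq_one hr hs h h' (y := θ (↑k⁻¹ : UCheck r s))
      (by rw [← map_mul, Units.mul_inv, map_one])
  obtain ⟨l₁, hl₁, m₁, n₁, hk₁⟩ := hunit (k₁ r s)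
  obtain ⟨l₂, hl₂, m₂, n₂, hk₂⟩ := hunit (k₂ r s)
  have c₁₁ := congrArg θ (k₁_mul_e₁ (r := r) (s := s))
  have c₁₂ := congrArg θ (k₁_mul_e₂ (r := r) (s := s))
  have c₂₁ := congrArg θ (k₂_mul_e₁ (r := r) (s := s))
  have c₂₂ := congrArg θ (k₂_mul_e₂ (r := r) (s := s))
  rw [map_smul, map_mul, map_mul, hk₁,
    -- The scalars are put in the form `r ^ p * s ^ q` required by `weight_of_commutation`.
    show (s ^ 2)⁻¹ = r ^ (0 : ℤ) * s ^ (-2 : ℤ) by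
      rw [zpow_zero, one_mul, zpow_neg]; norm_cast] at c₁₁
  rw [map_smul, map_mul, map_mul, hk₁,
    show r * s = r ^ (1 : ℤ) * s ^ (1 : ℤ) by rw [zpow_one, zpow_one]] at c₁₂
  rw [map_smul, map_mul, map_mul, hk₂,
    show r⁻¹ * s⁻¹ = r ^ (-1 : ℤ) * s ^ (-1 : ℤ) by rw [zpow_neg_one, zpow_neg_one]] at c₂₁
  rw [map_smul, map_mul, map_mul, hk₂,
    show (r • (θ (e₂ r s) * l₂ • kpow r s m₂ n₂)) =
      (r ^ (1 : ℤ) * s ^ (0 : ℤ)) • (θ (e₂ r s) * l₂ • kpow r s m₂ n₂) by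
      rw [zpow_one, zpow_zero, mul_one]] at c₂₂
  have ne₁ : θ (e₁ r s) ≠ 0 := (map_ne_zero_iff θ θ.injective).2 (e₁_ne_zero hr hs h)
  have ne₂ : θ (e₂ r s) ≠ 0 := (map_ne_zero_iff θ θ.injective).2 (e₂_ne_zero hr hs h)
  have key : ∀ α β, (torusHom hr hs h (θ (e₁ r s))).coeff α ≠ 0 →
      (torusHom hr hs h (θ (e₂ r s))).coeff β ≠ 0 →
      m₁ = 1 ∧ n₁ = 0 ∧ m₂ = 0 ∧ n₂ = 1 ∧ wt α = (1, 0) ∧ wt β = (0, 1) := fun α β hα hβ =>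
    weight_equations (wt_nonneg hr hs h hα).2 (wt_nonneg hr hs h hα).1 (wt_nonneg hr hs h hβ).1
      (weight_of_commutation hr hs h hrs hl₁ c₁₁ hα)
      (weight_of_commutation hr hs h hrs hl₂ c₂₁ hα)
      (weight_of_commutation hr hs h hrs hl₁ c₁₂ hβ)
      (weight_of_commutation hr hs h hrs hl₂ c₂₂ hβ)
  obtain ⟨α, hα⟩ := exists_coeff_ne_zero (torusHom_ne_zero_of_ne_zero hr hs h h' ne₁)
  obtain ⟨β, hβ⟩ := exists_coeff_ne_zero (torusHom_ne_zero_of_ne_zero hr hs h h' ne₂)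
  obtain ⟨rfl, rfl, rfl, rfl, -, -⟩ := key α β hα hβ
  refine ⟨⟨l₁, hl₁, by rw [hk₁, k₁_eq_kpow]⟩, ⟨l₂, hl₂, by rw [hk₂, k₂_eq_kpow]⟩, ?_, ?_⟩
  · exact exists_eq_mul_e₁ hr hs h h' fun γ hγ => (key γ β hγ hβ).2.2.2.2.1
  · exact exists_eq_mul_e₂ hr hs h h' fun γ hγ => (key α γ hα hγ).2.2.2.2.2

include hr hs h h' in
-- Applying `θ.symm` to `θ e = z * e` gives `e = θ.symm z * w * e`. Cancelling `e` in a domain and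
-- applying `θ` shows `z * θ w = 1`, so the description of units applies to `z`.
theorem exists_eq_smul_kpow_mul (θ : UCheck r s ≃ₐ[ℂ] UCheck r s) {e z w : UCheck r s}
    (he : e ≠ 0) (hz : θ e = z * e) (hw : θ.symm e = w * e) :
    ∃ c : ℂ, c ≠ 0 ∧ ∃ m n : ℤ, θ e = c • (kpow r s m n * e) := by
  have h₁ : (θ.symm z * w - 1) * e = 0 := by
    rw [sub_mul, one_mul, mul_assoc, ← hw, ← map_mul, ← hz, AlgEquiv.symm_apply_apply, sub_self]
  have h₂ := sub_eq_zero.1 ((mul_eq_zero' hr hs h h' h₁).resolve_right he)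
  have h₃ : z * θ w = 1 := by
    have := congrArg θ h₂
    rwa [map_mul, AlgEquiv.apply_symm_apply, map_one] at this
  obtain ⟨c, hc, m, n, rfl⟩ := eq_smul_kpow_of_mul_eq_one hr hs h h' h₃
  exact ⟨c, hc, m, n, by rw [hz, smul_mul_assoc]⟩

include hr hs h h' in
theorem e₁_mul_kpow (m n : ℤ) :
    e₁ r s * kpow r s m n = (r ^ n * s ^ (2 * m + n)) • (kpow r s m n * e₁ r s) := by
  apply torusHom_injective hr hs h h'
  rw [map_smul, map_mul, map_mul, torusHom_kpow, torusHom_e₁]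
  simp only [mul_add, add_mul, mul_smul_comm, smul_mul_assoc, xpow_mul_xpow, smul_smul, smul_add]
  norm_num
  rw [show -n + 2 * n = n by ring, show -(2 * m) + 4 * m + n = 2 * m + n by ring, mul_comm]

include hr hs h h' in
theorem e₂_mul_kpow (m n : ℤ) :
    e₂ r s * kpow r s m n = (r ^ (-m - n) * s ^ (-m)) • (kpow r s m n * e₂ r s) := by
  apply torusHom_injective hr hs h h'
  rw [map_smul, map_mul, map_mul, torusHom_kpow, torusHom_e₂]
  simp only [xpow_mul_xpow, smul_smul]
  norm_num

theorem vec_inj {a b c x m n a' b' c' x' m' n' : ℤ} :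
    vec a b c x m n = vec a' b' c' x' m' n' ↔
      a = a' ∧ b = b' ∧ c = c' ∧ x = x' ∧ m = m' ∧ n = n' := by
  constructor
  · intro h
    exact ⟨congrArg (crd 0) h, congrArg (crd 1) h, congrArg (crd 2) h, congrArg (crd 3) h,
      congrArg (crd 4) h, congrArg (crd 5) h⟩
  · rintro ⟨rfl, rfl, rfl, rfl, rfl, rfl⟩
    rfl

include hr hs h h' in
-- Two monomials of the image of `e₁` commute past that of `e₂` with different factors, `r²` and
-- `rs`; comparing their coefficients isolates `c`.
theorem left_coeff_eq_zero {c d : ℂ} (hcd : c • (e₁ r s * e₂ r s) + d • (e₂ r s * e₁ r s) = 0) :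
    c = 0 := by
  have h₀ := congrArg (torusHom hr hs h) hcd
  rw [map_add, map_smul, map_smul, map_mul, map_mul, torusHom_e₁, torusHom_e₂, map_zero] at h₀
  simp only [mul_add, add_mul, mul_smul_comm, smul_mul_assoc, xpow_mul_xpow, smul_smul,
    smul_add] at h₀
  norm_num at h₀
  have h₁ := congrArg (fun t => coeff t (vec 1 0 0 1 0 0)) h₀
  have h₂ := congrArg (fun t => coeff t (vec 0 1 0 1 0 0)) h₀
  simp [xpow, coeff_mono, vec_inj] at h₁ h₂
  have h₃ : c * (r * (r - s)) = 0 := by linear_combination h₁ - h₂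
  exact (mul_eq_zero.1 h₃).resolve_right (mul_ne_zero hr (sub_ne_zero.2 h'))

/-- Collecting `K K L` on the left costs one common factor `p`, from an `x` passing a `K`. Each `x`
passing `L` costs `q` and each `y` passing `K` costs `u`. -/
theorem serre_twist {A : Type*} [Ring A] [Algebra ℂ A] {K L x y : A} {p q u c d : ℂ}
    (hKL : L * K = K * L) (hxK : x * K = p • (K * x)) (hxL : x * L = q • (L * x))
    (hyK : y * K = u • (K * y)) :
    (K * x) ^ 2 * (L * y) - c • ((K * x) * (L * y) * (K * x)) + d • ((L * y) * (K * x) ^ 2) =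
      p • (K * K * L * (q ^ 2 • (x ^ 2 * y) - (c * (q * u)) • (x * y * x)
        + (d * u ^ 2) • (y * x ^ 2))) := by
  have hKL' (z : A) : L * (K * z) = K * (L * z) := by rw [← mul_assoc, hKL, mul_assoc]
  have hxK' (z : A) : x * (K * z) = p • (K * (x * z)) := by
    rw [← mul_assoc, hxK, smul_mul_assoc, mul_assoc]
  have hxL' (z : A) : x * (L * z) = q • (L * (x * z)) := by
    rw [← mul_assoc, hxL, smul_mul_assoc, mul_assoc]
  have hyK' (z : A) : y * (K * z) = u • (K * (y * z)) := by
    rw [← mul_assoc, hyK, smul_mul_assoc, mul_assoc]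
  simp only [pow_two, mul_assoc, mul_add, mul_sub, hKL', hxK', hxL', hyK', mul_smul_comm,
    smul_mul_assoc, smul_smul]
  module

include hr hs h h' in
-- The twisted Serre relation must be proportional to the original one, which forces `q = u`.
theorem twist_eq (hss : r ^ 2 + s ^ 2 ≠ 0) {a b c d : ℤ} {γ₁ γ₂ : ℂ} (hγ₁ : γ₁ ≠ 0)
    (hγ₂ : γ₂ ≠ 0) (θ : UCheck r s →ₐ[ℂ] UCheck r s)
    (h₁ : θ (e₁ r s) = γ₁ • (kpow r s a b * e₁ r s))
    (h₂ : θ (e₂ r s) = γ₂ • (kpow r s c d * e₂ r s)) :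
    r ^ d * s ^ (2 * c + d) = r ^ (-a - b) * s ^ (-a) := by
  have hserre := congrArg θ (serre₁ (r := r) (s := s))
  have hxK := e₁_mul_kpow hr hs h h' a b
  have hxL := e₁_mul_kpow hr hs h h' c d
  have hyK := e₂_mul_kpow hr hs h h' a b
  have hp : r ^ b * s ^ (2 * a + b) ≠ 0 := mul_ne_zero (zpow_ne_zero _ hr) (zpow_ne_zero _ hs)
  have hq : r ^ d * s ^ (2 * c + d) ≠ 0 := mul_ne_zero (zpow_ne_zero _ hr) (zpow_ne_zero _ hs)
  set p := r ^ b * s ^ (2 * a + b)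
  set q := r ^ d * s ^ (2 * c + d)
  set u := r ^ (-a - b) * s ^ (-a)
  set K := kpow r s a b with hK
  set L := kpow r s c d with hL
  have hKL : L * K = K * L := by
    rw [hK, hL, kpow_mul_kpow, kpow_mul_kpow, add_comm a, add_comm b]
  simp only [map_add, map_sub, map_smul, map_mul, map_pow, map_zero, h₁, h₂] at hserre
  have e₀ : (γ₁ ^ 2 * γ₂) • ((K * e₁ r s) ^ 2 * (L * e₂ r s)
      - (r ^ 2 + s ^ 2) • ((K * e₁ r s) * (L * e₂ r s) * (K * e₁ r s))
      + (r ^ 2 * s ^ 2) • ((L * e₂ r s) * (K * e₁ r s) ^ 2)) = 0 := by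
    rw [← hserre]
    simp only [smul_pow, smul_mul_assoc, mul_smul_comm, smul_smul]
    module
  rw [smul_eq_zero_iff_right (mul_ne_zero (pow_ne_zero 2 hγ₁) hγ₂),
    serre_twist hKL hxK hxL hyK, smul_eq_zero_iff_right hp, hK, hL, kpow_mul_kpow,
    kpow_mul_kpow] at e₀
  have hk (m n : ℤ) : kpow r s m n ≠ 0 := fun h0 => by
    have := (isLead_mono (q := bichar hr hs) (vec 0 0 0 0 m n) (one_ne_zero (α := ℂ))).ne_zero
    rw [← xpow, ← torusHom_kpow hr hs h, h0, map_zero] at this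
    exact this rfl
  have e₂ := (mul_eq_zero' hr hs h h' e₀).resolve_left (hk _ _)
  -- Eliminating `e₁² e₂` by the original relation leaves terms that all end in `e₁`, which can be
  -- cancelled on the right.
  have e₃ : (((r ^ 2 + s ^ 2) * (q * (q - u))) • (e₁ r s * AugB2.e₂ r s)
      + (r ^ 2 * s ^ 2 * (u ^ 2 - q ^ 2)) • (AugB2.e₂ r s * e₁ r s)) * e₁ r s = 0 := by
    have h₀ := serre₁ (r := r) (s := s)
    have h₃ : e₁ r s ^ 2 * AugB2.e₂ r s = (r ^ 2 + s ^ 2) • (e₁ r s * AugB2.e₂ r s * e₁ r s)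
        - (r ^ 2 * s ^ 2) • (AugB2.e₂ r s * e₁ r s ^ 2) := by
      rw [← sub_eq_zero, ← h₀]; abel
    rw [h₃] at e₂
    rw [← e₂]
    simp only [add_mul, smul_mul_assoc, mul_assoc, pow_two]
    module
  have e₄ := left_coeff_eq_zero hr hs h h'
    ((mul_eq_zero' hr hs h h' e₃).resolve_right (e₁_ne_zero hr hs h))
  have e₅ := (mul_eq_zero.1 ((mul_eq_zero.1 e₄).resolve_left hss)).resolve_left hq
  exact sub_eq_zero.1 e₅

theorem homog_smul_kpow_mul {w : ℤ × ℤ} {x : UCheck r s} (γ : ℂ) (m n : ℤ)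
    (hx : Homog wt w (torusHom hr hs h x)) :
    Homog wt w (torusHom hr hs h (γ • (kpow r s m n * x))) := by
  rw [map_smul, map_mul, torusHom_kpow]
  have := (homog_xpow hr hs (a := 0) (b := 0) (c := 0) (x := 0) (m := m) (n := n) (w := 0) rfl).mul
    hx
  rw [zero_add] at this
  exact this.smul γ

theorem weight_unique {w w' : ℤ × ℤ} {t : QTorus hr hs} (ht : t ≠ 0) (hw : Homog wt w t)
    (hw' : Homog wt w' t) : w = w' := by
  obtain ⟨α, hα⟩ := exists_coeff_ne_zero ht
  rw [← hw α hα, hw' α hα]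

end Automorphisms

end AugB2

theorem mainTheorem2 (r s : ℂ) (hr : r ≠ 0) (hs : s ≠ 0)
    (hrs : ∀ m n : ℤ, r ^ m * s ^ n = 1 → m = 0 ∧ n = 0)
    (θ : AugB2.UCheck r s ≃ₐ[ℂ] AugB2.UCheck r s) :
    (∃ (l₁ l₂ γ₁ γ₂ : ℂ) (a b c d : ℤ),
      l₁ ≠ 0 ∧ l₂ ≠ 0 ∧ γ₁ ≠ 0 ∧ γ₂ ≠ 0 ∧
      b = 2 * c ∧ a + 2 * c + d = 0 ∧
      θ (AugB2.k₁ r s : AugB2.UCheck r s) = l₁ • (AugB2.k₁ r s : AugB2.UCheck r s) ∧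
      θ (AugB2.k₂ r s : AugB2.UCheck r s) = l₂ • (AugB2.k₂ r s : AugB2.UCheck r s) ∧
      θ (AugB2.e₁ r s) = γ₁ • (AugB2.kpow r s a b * AugB2.e₁ r s) ∧
      θ (AugB2.e₂ r s) = γ₂ • (AugB2.kpow r s c d * AugB2.e₂ r s)) ∧
    (∀ (γ : ℂ) (m n : ℤ), θ (AugB2.e₁ r s) ≠ γ • (AugB2.kpow r s m n * AugB2.e₂ r s)) ∧
    (∀ (γ : ℂ) (m n : ℤ), θ (AugB2.e₂ r s) ≠ γ • (AugB2.kpow r s m n * AugB2.e₁ r s)) := by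
  -- Used with `k = 1, 2, 4` to exclude the vanishing of `r - s`, `r + s` and `r² + s²`.
  have pow_ne (k : ℕ) (hk : k ≠ 0) : r ^ k ≠ s ^ k := by
    intro heq
    have := (hrs k (-k) (by
      rw [zpow_neg, zpow_natCast, zpow_natCast, heq, mul_inv_cancel₀ (pow_ne_zero k hs)])).1
    exact hk (by exact_mod_cast this)
  have h' : r ≠ s := fun heq => pow_ne 1 one_ne_zero (by rw [heq])
  have h : r + s ≠ 0 := fun heq => pow_ne 2 two_ne_zero (by linear_combination (r - s) * heq)
  have hss : r ^ 2 + s ^ 2 ≠ 0 := fun heq =>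
    pow_ne 4 four_ne_zero (by linear_combination (r ^ 2 - s ^ 2) * heq)
  obtain ⟨⟨l₁, hl₁, hk₁⟩, ⟨l₂, hl₂, hk₂⟩, ⟨z₁, hz₁⟩, ⟨z₂, hz₂⟩⟩ :=
    AugB2.aut_generators hr hs h h' hrs θ
  obtain ⟨-, -, ⟨w₁, hw₁⟩, ⟨w₂, hw₂⟩⟩ := AugB2.aut_generators hr hs h h' hrs θ.symm
  have ne₁ := AugB2.e₁_ne_zero hr hs h
  have ne₂ := AugB2.e₂_ne_zero hr hs h
  obtain ⟨γ₁, hγ₁, a, b, he₁⟩ := AugB2.exists_eq_smul_kpow_mul hr hs h h' θ ne₁ hz₁ hw₁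
  obtain ⟨γ₂, hγ₂, c, d, he₂⟩ := AugB2.exists_eq_smul_kpow_mul hr hs h h' θ ne₂ hz₂ hw₂
  have htwist := AugB2.twist_eq hr hs h h' hss hγ₁ hγ₂ (θ : _ →ₐ[ℂ] _) he₁ he₂
  -- Independence of `r` and `s` gives `a + b + d = 0` and `a + 2c + d = 0`, hence `b = 2c`.
  have hexp := hrs (d - (-a - b)) (2 * c + d - -a) (by
    rw [zpow_sub₀ hr, zpow_sub₀ hs, div_mul_div_comm, htwist]
    exact div_self (mul_ne_zero (zpow_ne_zero _ hr) (zpow_ne_zero _ hs)))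
  have im₁ := AugB2.torusHom_ne_zero_of_ne_zero hr hs h h' ((map_ne_zero_iff θ θ.injective).2 ne₁)
  have im₂ := AugB2.torusHom_ne_zero_of_ne_zero hr hs h h' ((map_ne_zero_iff θ θ.injective).2 ne₂)
  have wt₁ := fun γ m n => AugB2.homog_smul_kpow_mul hr hs h γ m n (AugB2.homog_e₁ hr hs h)
  have wt₂ := fun γ m n => AugB2.homog_smul_kpow_mul hr hs h γ m n (AugB2.homog_e₂ hr hs h)
  refine ⟨⟨l₁, l₂, γ₁, γ₂, a, b, c, d, hl₁, hl₂, hγ₁, hγ₂, by omega, by omega, hk₁, hk₂, he₁, he₂⟩,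
    fun γ m n heq => ?_, fun γ m n heq => ?_⟩
  -- An exchange would give one nonzero element both weights `(1, 0)` and `(0, 1)`.
  · have := AugB2.weight_unique hr hs im₁ (he₁ ▸ wt₁ γ₁ a b) (heq ▸ wt₂ γ m n)
    simp at this
  · have := AugB2.weight_unique hr hs im₂ (he₂ ▸ wt₂ γ₂ c d) (heq ▸ wt₁ γ m n)
    simp at this
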